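/- Let $V$ be a vertex operator algebra over $\mathbb C$, $z$ a nonzero complex number, $A$ a weak $V\otimes V$-module (a module without any grading assumption), and $W=\coprod_{h\in\mathbb C}W_{(h)}$ an (ordinary) $V$-module, graded by the $L(0)$-eigenspaces, with $\dim W_{(h)}<\infty$ and $W_{(h)}=0$ for $\operatorname{Re}h$ sufficiently small. Put $\overline W=\prod_{h}W_{(h)}$, and let $W'=\coprod_h W_{(h)}^*$ be the contragredient module, $\langle Y(v,x)w',w\rangle=\langle w',Y^o(v,x)w\rangle$, where $Y^o(v,x)=Y(e^{xL(1)}(-x^{-2})^{L(0)}v,x^{-1})$. Write $Y_1(v,x)=Y_A(v\otimes\mathbf 1,x)$, $Y_2(v,x)=Y_A(\mathbf 1\otimes v,x)$ and $\delta(x)=\sum_{n\in\mathbb Z}x^n$, where $n$-th powers of a binomial are expanded in nonnegative powers of its second term. A linear map $F:A\to\overline W$ is called a $P(z)$-intertwining map if, for all $v\in V$ and $a\in A$, $$x_0^{-1}\delta\Big(\frac{x_1-z}{x_0}\Big)Y(v,x_1)F(a)-x_0^{-1}\delta\Big(\frac{z-x_1}{-x_0}\Big)F(Y_2(v,x_1)a)=z^{-1}\delta\Big(\frac{x_1-x_0}{z}\Big)F(Y_1(v,x_0)a),$$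 where the action of $V$ on $W$ is extended to $\overline W$; let $\mathcal M_{P(z)}(A,W)$ be the space of these maps. For $v\in V$ and $\lambda\in A^*$ define $Y'_{P(z)}(v,x)\lambda\in A^*[[x,x^{-1}]]$ by $$\langle Y'_{P(z)}(v,x)\lambda,a\rangle=\operatorname{Res}_{x_0}z^{-1}\delta\Big(\frac{x^{-1}-x_0}{z}\Big)\langle\lambda,Y_1(e^{xL(1)}(-x^{-2})^{L(0)}v,x_0)a\rangle+\operatorname{Res}_{x_0}x_0^{-1}\delta\Big(\frac{z-x^{-1}}{-x_0}\Big)\langle\lambda,Y_2^o(v,x)a\rangle .$$ Let $\tilde T'_{P(z)}(A)\subset A^*$ be the subspace of all $\lambda$ such that (a) for every $v\in V$, $Y'_{P(z)}(v,x)\lambda$ involves only finitely many negative powers of $x$, and (b) for all $v\in V$ and $a\in A$, $$x_0^{-1}\delta\Big(\frac{x_1^{-1}-z}{x_0}\Big)\langle Y'_{P(z)}(v,x_1)\lambda,a\rangle=z^{-1}\delta\Big(\frac{x_1^{-1}-x_0}{z}\Big)\langle\lambda,Y_1(e^{x_1L(1)}(-x_1^{-2})^{L(0)}v,x_0)a\rangle+x_0^{-1}\delta\Big(\frac{z-x_1^{-1}}{-x_0}\Big)\langle\lambda,Y_2^o(v,x_1)a\rangle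 .$$ With $Y'_{P(z)}$ this is a weak $V$-module; let $T'_{P(z)}(A)$ be the sum of all its (ordinary) $V$-submodules. **Theorem.** Let $F:A\to\overline W$ be a linear map, and define $F^*|_{W'}:W'\to A^*$ by $\langle F^*(w'),a\rangle=\langle w',F(a)\rangle$. Then $F$ is a $P(z)$-intertwining map if and only if $F^*|_{W'}$ is a $V$-homomorphism from $W'$ into $\tilde T'_{P(z)}(A)$. Furthermore, $F\mapsto F^*|_{W'}$ is a linear isomorphism from $\mathcal M_{P(z)}(A,W)$ onto $\operatorname{Hom}_V(W',T'_{P(z)}(A))$. -/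

import Mathlib

open scoped TensorProduct

noncomputable section

/-! ### Weight spaces

The homogeneous subspaces `M_(h)` of a (generalized) module are the eigenspaces of `L(0)`. -/

theorem bijective_coeLinearMap_eigenspace {M : Type*} [AddCommGroup M] [Module ℂ M]
    (T : Module.End ℂ M) (hT : ⨆ μ : ℂ, T.eigenspace μ = ⊤) :
    Function.Bijective (DirectSum.coeLinearMap fun μ : ℂ => T.eigenspace μ) :=
  DirectSum.isInternal_submodule_of_iSupIndep_of_iSup_eq_top T.eigenspaces_iSupIndep hT

/-- The projection of `M = ∐_h M_(h)` onto `M_(μ)`, where `M_(h)` is the `h`-eigenspace of `T`. -/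
def wtProj {M : Type*} [AddCommGroup M] [Module ℂ M] (T : Module.End ℂ M)
    (hT : ⨆ μ : ℂ, T.eigenspace μ = ⊤) (μ : ℂ) : M →ₗ[ℂ] T.eigenspace μ :=
  DirectSum.component ℂ ℂ (fun μ : ℂ => T.eigenspace μ) μ ∘ₗ
    (LinearEquiv.ofBijective (DirectSum.coeLinearMap fun μ : ℂ => T.eigenspace μ)
      (bijective_coeLinearMap_eigenspace T hT)).symm.toLinearMap

theorem wtProj_finite {M : Type*} [AddCommGroup M] [Module ℂ M] (T : Module.End ℂ M)
    (hT : ⨆ μ : ℂ, T.eigenspace μ = ⊤) (x : M) : {μ : ℂ | wtProj T hT μ x ≠ 0}.Finite :=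
  DFinsupp.finite_support _

theorem wtProj_of_ne {M : Type*} [AddCommGroup M] [Module ℂ M] (T : Module.End ℂ M)
    (hT : ⨆ μ : ℂ, T.eigenspace μ = ⊤) {μ ν : ℂ} (h : ν ≠ μ) {x : M}
    (hx : x ∈ T.eigenspace ν) : wtProj T hT μ x = 0 := by
  have h1 : (LinearEquiv.ofBijective (DirectSum.coeLinearMap fun μ : ℂ => T.eigenspace μ)
      (bijective_coeLinearMap_eigenspace T hT)).symm x
      = DirectSum.lof ℂ ℂ (fun μ : ℂ => T.eigenspace μ) ν ⟨x, hx⟩ := by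
    rw [LinearEquiv.symm_apply_eq, LinearEquiv.ofBijective_apply, DirectSum.coeLinearMap_lof]
  rw [wtProj, LinearMap.comp_apply, LinearEquiv.coe_coe, h1]
  exact DFinsupp.single_eq_of_ne h.symm

/-! ### Vertex operator algebras and modules -/

/-- The data of a vertex operator algebra: the vertex operator map
`Y(u, x) = ∑ₙ uₙ x^(-n-1)`, with `Y u n` the mode `uₙ`, the vacuum vector, the Virasoro element
and the rank. -/
structure VertexData (V : Type*) [AddCommGroup V] [Module ℂ V] where
  Y : V →ₗ[ℂ] ℤ → Module.End ℂ V
  vac : V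
  vir : V
  rank : ℂ

/-- The axioms of a module over the vertex operator algebra `D` that do not involve gradings, for
`Y(u, x) = ∑ₙ uₙ x^(-n-1)` with `Y u n` the mode `uₙ` acting on `M`. -/
structure IsWeakModule {V M : Type*} [AddCommGroup V] [Module ℂ V] [AddCommGroup M] [Module ℂ M]
    (D : VertexData V) (Y : V →ₗ[ℂ] ℤ → Module.End ℂ M) : Prop where
  /-- `Y(u, x) w ∈ M((x))`. -/
  trunc : ∀ (u : V) (w : M), ∃ N : ℤ, ∀ n ≥ N, Y u n w = 0
  /-- `Y(𝟏, x) = 1`. -/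
  vacuum : ∀ n : ℤ, Y D.vac n = if n = -1 then 1 else 0
  /-- The Jacobi identity, written out in components: the coefficient of
  `x₀^(-l-1) x₁^(-m-1) x₂^(-n-1)` of
  `x₀⁻¹ δ((x₁-x₂)/x₀) Y(u,x₁) Y(v,x₂) - x₀⁻¹ δ((x₂-x₁)/(-x₀)) Y(v,x₂) Y(u,x₁)
    = x₂⁻¹ δ((x₁-x₀)/x₂) Y(Y(u,x₀)v, x₂)`. -/
  jacobi : ∀ (u v : V) (l m n : ℤ) (w : M),
    (∑ᶠ i : ℕ, ((-1 : ℂ) ^ i * (Ring.choose l i : ℤ)) • Y u (l + m - i) (Y v (n + i) w))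
      - (∑ᶠ i : ℕ, ((-1 : ℂ) ^ l * (-1 : ℂ) ^ i * (Ring.choose l i : ℤ)) •
          Y v (l + n - i) (Y u (m + i) w))
      = ∑ᶠ i : ℕ, ((Ring.choose m i : ℤ) : ℂ) • Y (D.Y u (l + i) v) (m + n - i) w
  /-- The Virasoro relations for `L(n) = ω_(n+1)`. -/
  virasoro : ∀ m n : ℤ,
    Y D.vir (m + 1) * Y D.vir (n + 1) - Y D.vir (n + 1) * Y D.vir (m + 1)
      = ((m : ℂ) - n) • Y D.vir (m + n + 1)
        + (if m + n = 0 then ((m : ℂ) ^ 3 - m) / 12 * D.rank else 0) • (1 : Module.End ℂ M)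
  /-- `Y(L(-1)u, x) = d/dx Y(u, x)`. -/
  derivative : ∀ (u : V) (n : ℤ), Y (D.Y D.vir 0 u) n = -(n : ℂ) • Y u (n - 1)

/-- `M = ∐_{h ∈ ℂ} M_(h)` with `M_(h)` the `h`-eigenspace of `T = L(0)`, together with the two
grading restrictions: `dim M_(h) < ∞`, and `M_(h) = 0` if the real part of `h` is
sufficiently small. -/
structure IsOrdinaryGrading {M : Type*} [AddCommGroup M] [Module ℂ M] (T : Module.End ℂ M) :
    Prop where
  iSup_eq_top : ⨆ h : ℂ, T.eigenspace h = ⊤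
  finite_dimensional : ∀ h : ℂ, FiniteDimensional ℂ (T.eigenspace h)
  lower_trunc : ∃ r : ℝ, ∀ h : ℂ, h.re < r → T.eigenspace h = ⊥

/-- A vertex operator algebra `V = ∐_{n ∈ ℤ} V_(n)`, with `V_(n)` the `n`-eigenspace
of `L(0) = ω₁`. -/
structure VertexOperatorAlgebra (V : Type*) [AddCommGroup V] [Module ℂ V] extends
    VertexData V where
  /-- truncation, vacuum property, Jacobi identity, Virasoro relations, `L(-1)`-derivative
  property -/
  adjoint : IsWeakModule toVertexData Y
  /-- `Y(u, x)𝟏 ∈ V[[x]]` has constant term `u`. -/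
  creation : ∀ u : V, (∀ n : ℤ, 0 ≤ n → Y u n vac = 0) ∧ Y u (-1) vac = u
  grading : ⨆ n : ℤ, (Y vir 1).eigenspace (n : ℂ) = ⊤
  finite_dimensional : ∀ n : ℤ, FiniteDimensional ℂ ((Y vir 1).eigenspace (n : ℂ))
  lower_trunc : ∃ N : ℤ, ∀ n < N, (Y vir 1).eigenspace (n : ℂ) = ⊥
  vac_mem : vac ∈ (Y vir 1).eigenspace (0 : ℂ)
  vir_mem : vir ∈ (Y vir 1).eigenspace (2 : ℂ)

/-- A weak module over (the vertex operator algebra with data) `D`. -/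
structure WeakModule {V : Type*} [AddCommGroup V] [Module ℂ V] (D : VertexData V)
    (M : Type*) [AddCommGroup M] [Module ℂ M] where
  Y : V →ₗ[ℂ] ℤ → Module.End ℂ M
  isWeakModule : IsWeakModule D Y

/-- An (ordinary) module: a weak module that is graded by the eigenvalues of `L(0)` with the two
grading restrictions. -/
structure OrdinaryModule {V : Type*} [AddCommGroup V] [Module ℂ V] (D : VertexData V)
    (M : Type*) [AddCommGroup M] [Module ℂ M] extends WeakModule D M where
  isOrdinary : IsOrdinaryGrading (Y D.vir 1)

/-- `[L(0), uₙ] = (wt u - n - 1) uₙ`: modes of homogeneous vectors shift weights. -/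
theorem IsWeakModule.mode_mem {V M : Type*} [AddCommGroup V] [Module ℂ V] [AddCommGroup M]
    [Module ℂ M] {D : VertexData V} {Y : V →ₗ[ℂ] ℤ → Module.End ℂ M} (hY : IsWeakModule D Y)
    {u : V} {k : ℂ} (hu : u ∈ (D.Y D.vir 1).eigenspace k) {w : M} {h : ℂ}
    (hw : w ∈ (Y D.vir 1).eigenspace h) (n : ℤ) :
    Y u n w ∈ (Y D.vir 1).eigenspace (h + k - n - 1) := by
  rw [Module.End.mem_eigenspace_iff] at hu hw ⊢
  have hj := hY.jacobi D.vir u 0 1 n w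
  rw [finsum_eq_single _ 0 (by intro i hi; simp [Ring.choose_zero_pos ℤ (Nat.pos_of_ne_zero hi)]),
    finsum_eq_single _ 0 (by intro i hi; simp [Ring.choose_zero_pos ℤ (Nat.pos_of_ne_zero hi)])] at hj
  have hc : ∀ i : ℕ, 2 ≤ i → Ring.choose (1 : ℤ) i = 0 := by
    intro i hi
    have := Ring.choose_natCast (R := ℤ) 1 i
    rw [Nat.choose_eq_zero_of_lt (by omega)] at this
    simpa using this
  rw [finsum_eq_sum_of_support_subset (s := {0, 1}) _ (by
    intro i hi
    by_contra hne
    have : 2 ≤ i := by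
      simp only [Finset.coe_insert, Finset.coe_singleton, Set.mem_insert_iff,
        Set.mem_singleton_iff, not_or] at hne
      omega
    simp [hc i this] at hi)] at hj
  have hd := hY.derivative u (1 + n)
  simp [hw, hu] at hj hd
  rw [sub_eq_iff_eq_add] at hj
  rw [hj, hd]
  simp only [LinearMap.smul_apply]
  module

/-- The tensor product `V₁ ⊗ V₂`, where `Y(u ⊗ v, x) = Y(u, x) ⊗ Y(v, x)`, the vacuum vector is
`𝟏 ⊗ 𝟏`, the Virasoro element is `ω ⊗ 𝟏 + 𝟏 ⊗ ω` and the ranks add up. -/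
def VertexOperatorAlgebra.tensor {V₁ V₂ : Type*} [AddCommGroup V₁] [Module ℂ V₁]
    [AddCommGroup V₂] [Module ℂ V₂] (D₁ : VertexOperatorAlgebra V₁)
    (D₂ : VertexOperatorAlgebra V₂) : VertexData (V₁ ⊗[ℂ] V₂) :=
  have fin (u : V₁) (v : V₂) (n : ℤ) (u' : V₁) (v' : V₂) :
      (Function.support fun i : ℤ => D₁.Y u i u' ⊗ₜ[ℂ] D₂.Y v (n - 1 - i) v').Finite := by
    obtain ⟨N, hN⟩ := D₁.adjoint.trunc u u'
    obtain ⟨M, hM⟩ := D₂.adjoint.trunc v v'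
    refine (Set.finite_Icc (n - 1 - M) N).subset fun i hi => ?_
    by_contra hne
    rw [Set.mem_Icc, not_and_or, not_le, not_le] at hne
    rcases hne with h | h
    · simp [hM (n - 1 - i) (by omega)] at hi
    · simp [hN i (by omega)] at hi
  { Y := TensorProduct.lift <| LinearMap.mk₂ ℂ
      (fun u v n => TensorProduct.lift <| LinearMap.mk₂ ℂ
        (fun u' v' => ∑ᶠ i : ℤ, D₁.Y u i u' ⊗ₜ[ℂ] D₂.Y v (n - 1 - i) v')
        (fun a b v' => by
          rw [← finsum_add_distrib (fin ..) (fin ..)]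
          simp [TensorProduct.add_tmul])
        (fun c a v' => by
          rw [smul_finsum]
          simp [TensorProduct.smul_tmul'])
        (fun a b v' => by
          rw [← finsum_add_distrib (fin ..) (fin ..)]
          simp [TensorProduct.tmul_add])
        (fun c a v' => by
          rw [smul_finsum]
          simp))
      (fun a b v => by
        funext n
        refine TensorProduct.ext' fun u' v' => ?_
        simp only [TensorProduct.lift.tmul, LinearMap.mk₂_apply, Pi.add_apply,
          LinearMap.add_apply]
        rw [← finsum_add_distrib (fin ..) (fin ..)]
        simp [TensorProduct.add_tmul])
      (fun c a v => by
        funext n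
        refine TensorProduct.ext' fun u' v' => ?_
        simp only [TensorProduct.lift.tmul, LinearMap.mk₂_apply, Pi.smul_apply,
          LinearMap.smul_apply]
        rw [smul_finsum]
        simp [TensorProduct.smul_tmul'])
      (fun a b v => by
        funext n
        refine TensorProduct.ext' fun u' v' => ?_
        simp only [TensorProduct.lift.tmul, LinearMap.mk₂_apply, Pi.add_apply,
          LinearMap.add_apply]
        rw [← finsum_add_distrib (fin ..) (fin ..)]
        simp [TensorProduct.tmul_add])
      (fun c a v => by
        funext n
        refine TensorProduct.ext' fun u' v' => ?_
        simp only [TensorProduct.lift.tmul, LinearMap.mk₂_apply, Pi.smul_apply,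
          LinearMap.smul_apply]
        rw [smul_finsum]
        simp)
    vac := D₁.vac ⊗ₜ D₂.vac
    vir := D₁.vir ⊗ₜ D₂.vac + D₁.vac ⊗ₜ D₂.vir
    rank := D₁.rank + D₂.rank }

theorem VertexOperatorAlgebra.iSup_eq_top {V : Type*} [AddCommGroup V] [Module ℂ V]
    (𝒱 : VertexOperatorAlgebra V) : ⨆ μ : ℂ, (𝒱.Y 𝒱.vir 1).eigenspace μ = ⊤ :=
  top_le_iff.1 <| 𝒱.grading.symm.le.trans <|
    iSup_le fun n => le_iSup (fun μ : ℂ => (𝒱.Y 𝒱.vir 1).eigenspace μ) (n : ℂ)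

/-- A property of vectors that is additive holds for all vectors of `V` as soon as it holds for
homogeneous ones. -/
theorem VertexOperatorAlgebra.homogeneous_induction {V : Type*} [AddCommGroup V] [Module ℂ V]
    (𝒱 : VertexOperatorAlgebra V) {P : V → Prop} (v : V)
    (hom : ∀ (n : ℤ), ∀ u ∈ (𝒱.Y 𝒱.vir 1).eigenspace (n : ℂ), P u) (zero : P 0)
    (add : ∀ u u', P u → P u' → P (u + u')) : P v :=
  Submodule.iSup_induction (fun n : ℤ => (𝒱.Y 𝒱.vir 1).eigenspace (n : ℂ)) (motive := P)
    (𝒱.grading.symm ▸ Submodule.mem_top) hom zero add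

/-! ### Opposite vertex operators -/

/-- The coefficient of `x ^ k` in `e^(x L(1)) (-x⁻²)^(L(0)) v ∈ V[x, x⁻¹]`. If `v` is the sum of
its homogeneous components `vₙ`, this is the sum of all `(-1)ⁿ / j! L(1)^j vₙ`
with `j - 2 n = k`. -/
def VertexOperatorAlgebra.oppVec {V : Type*} [AddCommGroup V] [Module ℂ V]
    (𝒱 : VertexOperatorAlgebra V) (v : V) (k : ℤ) : V :=
  ∑ᶠ n : ℤ, if 0 ≤ 2 * n + k then
    ((-1 : ℂ) ^ n / ((2 * n + k).toNat.factorial : ℂ)) •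
      ((𝒱.Y 𝒱.vir 2) ^ (2 * n + k).toNat)
        (wtProj (𝒱.Y 𝒱.vir 1) 𝒱.iSup_eq_top (n : ℂ) v : V)
  else 0

/-- The mode with index `m` (the coefficient of `x^(-m-1)`) of the opposite vertex operator
`Yᵒ(v, x) = Y(e^(x L(1)) (-x⁻²)^(L(0)) v, x⁻¹)`. -/
def VertexOperatorAlgebra.oppMode {V M : Type*} [AddCommGroup V] [Module ℂ V] [AddCommGroup M]
    [Module ℂ M] (𝒱 : VertexOperatorAlgebra V) (Y : V →ₗ[ℂ] ℤ → Module.End ℂ M) (v : V) (m : ℤ) :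
    Module.End ℂ M :=
  ∑ᶠ k : ℤ, Y (𝒱.oppVec v k) (-m - 2 - k)

theorem VertexOperatorAlgebra.pow_mem {V : Type*} [AddCommGroup V] [Module ℂ V]
    (𝒱 : VertexOperatorAlgebra V) {n : ℤ} {v : V} (hv : v ∈ (𝒱.Y 𝒱.vir 1).eigenspace (n : ℂ))
    (j : ℕ) : ((𝒱.Y 𝒱.vir 2) ^ j) v ∈ (𝒱.Y 𝒱.vir 1).eigenspace ((n - j : ℤ) : ℂ) := by
  induction j with
  | zero => simpa using hv
  | succ j ih =>
    rw [pow_succ', Module.End.mul_apply]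
    have := 𝒱.adjoint.mode_mem 𝒱.vir_mem ih 2
    convert this using 2
    push_cast
    ring

theorem VertexOperatorAlgebra.oppVec_finite {V : Type*} [AddCommGroup V] [Module ℂ V]
    (𝒱 : VertexOperatorAlgebra V) (v : V) : {k : ℤ | 𝒱.oppVec v k ≠ 0}.Finite := by
  obtain ⟨N, hN⟩ := 𝒱.lower_trunc
  have hfin : {n : ℤ | wtProj (𝒱.Y 𝒱.vir 1) 𝒱.iSup_eq_top (n : ℂ) v ≠ 0}.Finite :=
    (wtProj_finite (𝒱.Y 𝒱.vir 1) 𝒱.iSup_eq_top v).preimage (Int.cast_injective.injOn)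
  refine (hfin.biUnion (t := fun n => Set.Icc (-2 * n) (-n - N)) fun n _ =>
    Set.finite_Icc _ _).subset fun k hk => ?_
  by_contra hne
  refine hk (finsum_eq_zero_of_forall_eq_zero fun n => ?_)
  split_ifs with h
  · by_cases h0 : wtProj (𝒱.Y 𝒱.vir 1) 𝒱.iSup_eq_top (n : ℂ) v = 0
    · simp [h0]
    · have h1 : ¬ (k ∈ Set.Icc (-2 * n) (-n - N)) := fun h2 =>
        hne (Set.mem_biUnion (show n ∈ _ from h0) h2)
      have h3 := 𝒱.pow_mem
        (wtProj (𝒱.Y 𝒱.vir 1) 𝒱.iSup_eq_top (n : ℂ) v).2 (2 * n + k).toNat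
      rw [Set.mem_Icc, not_and_or] at h1
      rw [hN _ (by omega), Submodule.mem_bot] at h3
      rw [h3, smul_zero]
  · rfl

/-! ### Formal series in two variables

A formal series `∑ f(i, j) x₀^i x₁^j` with coefficients in `M` is the
function `f : ℤ × ℤ → M`. -/

/-- The product of the scalar series `D` with the series `f`. It is used for products that exist,
that is, only finitely many terms contribute to each coefficient. -/
def seriesMul {M : Type*} [AddCommGroup M] [Module ℂ M] (D : ℤ × ℤ → ℂ) (f : ℤ × ℤ → M)
    (p : ℤ × ℤ) : M :=
  ∑ᶠ r : ℤ × ℤ, D (p - r) • f r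

/-- The series `∑ g(i) x₀^i`. -/
def inX₀ {M : Type*} [AddCommGroup M] (g : ℤ → M) (r : ℤ × ℤ) : M :=
  if r.2 = 0 then g r.1 else 0

/-- The series `∑ g(j) x₁^j`. -/
def inX₁ {M : Type*} [AddCommGroup M] (g : ℤ → M) (r : ℤ × ℤ) : M :=
  if r.1 = 0 then g r.2 else 0

/-- The series obtained by substituting `x₁⁻¹` for `x₁`. -/
def substInv (D : ℤ × ℤ → ℂ) (r : ℤ × ℤ) : ℂ := D (r.1, -r.2)

/-- `x₀⁻¹ δ((x₁ - z)/x₀) = ∑ₙ x₀^(-n-1) (x₁ - z)^n`, where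
`(x₁ - z)^n = ∑_{i ≥ 0} C(n, i) (-z)^i x₁^(n-i)`. -/
def deltaX₁SubZ (z : ℂ) (r : ℤ × ℤ) : ℂ :=
  let n := -r.1 - 1
  if r.2 ≤ n then (Ring.choose n (n - r.2).toNat : ℤ) * (-z) ^ (n - r.2).toNat else 0

/-- `x₀⁻¹ δ((z - x₁)/(-x₀)) = ∑ₙ (-1)^n x₀^(-n-1) (z - x₁)^n`, where
`(z - x₁)^n = ∑_{j ≥ 0} (-1)^j C(n, j) z^(n-j) x₁^j`. -/
def deltaZSubX₁ (z : ℂ) (r : ℤ × ℤ) : ℂ :=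
  let n := -r.1 - 1
  if 0 ≤ r.2 then
    (-1) ^ n * ((-1) ^ r.2.toNat * (Ring.choose n r.2.toNat : ℤ) * z ^ (n - r.2))
  else 0

/-- `z⁻¹ δ((x₁ - x₀)/z) = ∑ₙ z^(-n-1) (x₁ - x₀)^n`, where
`(x₁ - x₀)^n = ∑_{i ≥ 0} (-1)^i C(n, i) x₁^(n-i) x₀^i`. -/
def deltaX₁SubX₀ (z : ℂ) (r : ℤ × ℤ) : ℂ :=
  let n := r.1 + r.2
  if 0 ≤ r.1 then
    z ^ (-n - 1) * ((-1) ^ r.1.toNat * (Ring.choose n r.1.toNat : ℤ))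
  else 0

theorem seriesMul_add {M : Type*} [AddCommGroup M] [Module ℂ M] {D : ℤ × ℤ → ℂ}
    {f g : ℤ × ℤ → M} {p : ℤ × ℤ} (hf : (Function.support fun r => D (p - r) • f r).Finite)
    (hg : (Function.support fun r => D (p - r) • g r).Finite) :
    seriesMul D (fun r => f r + g r) p = seriesMul D f p + seriesMul D g p := by
  simp only [seriesMul, smul_add]
  exact finsum_add_distrib hf hg

theorem seriesMul_smul {M : Type*} [AddCommGroup M] [Module ℂ M] {D : ℤ × ℤ → ℂ}
    {f : ℤ × ℤ → M} {p : ℤ × ℤ} (c : ℂ) :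
    seriesMul D (fun r => c • f r) p = c • seriesMul D f p := by
  simp only [seriesMul, smul_finsum, smul_comm c]

theorem seriesMul_zero {M : Type*} [AddCommGroup M] [Module ℂ M] {D : ℤ × ℤ → ℂ} {p : ℤ × ℤ} :
    seriesMul D (fun _ => (0 : M)) p = 0 := by
  simp [seriesMul]

theorem inX₀_add {M : Type*} [AddCommGroup M] (f g : ℤ → M) :
    inX₀ (fun i => f i + g i) = fun r => inX₀ f r + inX₀ g r := by
  funext r; simp only [inX₀]; split_ifs <;> simp

theorem inX₁_add {M : Type*} [AddCommGroup M] (f g : ℤ → M) :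
    inX₁ (fun i => f i + g i) = fun r => inX₁ f r + inX₁ g r := by
  funext r; simp only [inX₁]; split_ifs <;> simp

theorem inX₀_smul {M : Type*} [AddCommGroup M] [Module ℂ M] (c : ℂ) (f : ℤ → M) :
    inX₀ (fun i => c • f i) = fun r => c • inX₀ f r := by
  funext r; simp only [inX₀]; split_ifs <;> simp

theorem inX₁_smul {M : Type*} [AddCommGroup M] [Module ℂ M] (c : ℂ) (f : ℤ → M) :
    inX₁ (fun i => c • f i) = fun r => c • inX₁ f r := by
  funext r; simp only [inX₁]; split_ifs <;> simp

theorem inX₀_zero {M : Type*} [AddCommGroup M] :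
    inX₀ (fun _ => (0 : M)) = fun _ => 0 := by
  funext r; simp [inX₀]

theorem inX₁_zero {M : Type*} [AddCommGroup M] :
    inX₁ (fun _ => (0 : M)) = fun _ => 0 := by
  funext r; simp [inX₁]

/-- Products `D(x₀, x₁) g(x₀)` exist if `D` has no negative powers of `x₀` and `g` is
lower truncated. -/
theorem finite_inX₀ {M : Type*} [AddCommGroup M] [Module ℂ M] {D : ℤ × ℤ → ℂ} {g : ℤ → M}
    (hD : ∀ r : ℤ × ℤ, r.1 < 0 → D r = 0) (hg : ∃ N : ℤ, ∀ i ≤ N, g i = 0) (p : ℤ × ℤ) :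
    (Function.support fun r => D (p - r) • inX₀ g r).Finite := by
  obtain ⟨N, hN⟩ := hg
  refine ((Set.finite_Icc N p.1).prod (Set.finite_singleton (0 : ℤ))).subset fun r hr => ?_
  by_contra hne
  rw [Set.mem_prod, not_and_or, Set.mem_Icc, Set.mem_singleton_iff] at hne
  refine hr ?_
  by_cases h2 : r.2 = 0
  · by_cases h1 : p.1 < r.1
    · simp [hD (p - r) (by simpa using h1)]
    · simp [inX₀, hN r.1 (by omega)]
  · simp [inX₀, h2]

/-- Products `D(x₀, x₁) g(x₁)` exist if, for each power of `x₀`, the powers of `x₁` in `D` are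
bounded below and `g` is lower truncated. -/
theorem finite_inX₁ {M : Type*} [AddCommGroup M] [Module ℂ M] {D : ℤ × ℤ → ℂ} {g : ℤ → M}
    (hD : ∀ i : ℤ, ∃ J : ℤ, ∀ j ≤ J, D (i, j) = 0) (hg : ∃ N : ℤ, ∀ i ≤ N, g i = 0)
    (p : ℤ × ℤ) : (Function.support fun r => D (p - r) • inX₁ g r).Finite := by
  obtain ⟨N, hN⟩ := hg
  obtain ⟨J, hJ⟩ := hD p.1
  refine ((Set.finite_singleton (0 : ℤ)).prod (Set.finite_Icc N (p.2 - J))).subset fun r hr => ?_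
  by_contra hne
  rw [Set.mem_prod, not_and_or, Set.mem_Icc, Set.mem_singleton_iff] at hne
  refine hr ?_
  by_cases h2 : r.1 = 0
  · by_cases h1 : p.2 - J < r.2
    · have : p - r = (p.1, p.2 - r.2) := by ext <;> simp [h2]
      simp [this, hJ (p.2 - r.2) (by omega)]
    · simp [inX₁, hN r.2 (by omega)]
  · simp [inX₁, h2]

/-- Products `D(x₀, x₁) g(x₁)` exist if, for each power of `x₀`, the powers of `x₁` in `D` are
bounded above and `g` is upper truncated. -/
theorem finite_inX₁' {M : Type*} [AddCommGroup M] [Module ℂ M] {D : ℤ × ℤ → ℂ} {g : ℤ → M}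
    (hD : ∀ i : ℤ, ∃ J : ℤ, ∀ j ≥ J, D (i, j) = 0) (hg : ∃ N : ℤ, ∀ i ≥ N, g i = 0)
    (p : ℤ × ℤ) : (Function.support fun r => D (p - r) • inX₁ g r).Finite := by
  obtain ⟨N, hN⟩ := hg
  obtain ⟨J, hJ⟩ := hD p.1
  refine ((Set.finite_singleton (0 : ℤ)).prod (Set.finite_Icc (p.2 - J) N)).subset fun r hr => ?_
  by_contra hne
  rw [Set.mem_prod, not_and_or, Set.mem_Icc, Set.mem_singleton_iff] at hne
  refine hr ?_
  by_cases h2 : r.1 = 0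
  · by_cases h1 : r.2 < p.2 - J
    · have : p - r = (p.1, p.2 - r.2) := by ext <;> simp [h2]
      simp [this, hJ (p.2 - r.2) (by omega)]
    · simp [inX₁, hN r.2 (by omega)]
  · simp [inX₁, h2]

theorem deltaX₁SubZ_above (z : ℂ) (i : ℤ) : ∃ J : ℤ, ∀ j ≥ J, deltaX₁SubZ z (i, j) = 0 :=
  ⟨-i, fun j hj => by simp only [deltaX₁SubZ]; rw [if_neg (by omega)]⟩

theorem substInv_deltaX₁SubZ_below (z : ℂ) (i : ℤ) :
    ∃ J : ℤ, ∀ j ≤ J, substInv (deltaX₁SubZ z) (i, j) = 0 :=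
  ⟨i, fun j hj => by simp only [substInv, deltaX₁SubZ]; rw [if_neg (by omega)]⟩

theorem deltaZSubX₁_below (z : ℂ) (i : ℤ) : ∃ J : ℤ, ∀ j ≤ J, deltaZSubX₁ z (i, j) = 0 :=
  ⟨-1, fun j hj => by simp only [deltaZSubX₁]; rw [if_neg (by omega)]⟩

theorem substInv_deltaZSubX₁_above (z : ℂ) (i : ℤ) :
    ∃ J : ℤ, ∀ j ≥ J, substInv (deltaZSubX₁ z) (i, j) = 0 :=
  ⟨1, fun j hj => by simp only [substInv, deltaZSubX₁]; rw [if_neg (by omega)]⟩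

theorem deltaX₁SubX₀_neg (z : ℂ) (r : ℤ × ℤ) (hr : r.1 < 0) : deltaX₁SubX₀ z r = 0 := by
  simp only [deltaX₁SubX₀]; rw [if_neg (by omega)]

/-! ### The vertex operator map `Y'_{P(z)}` and the `P(z)`-compatibility condition -/

section Pz

variable {V A : Type*} [AddCommGroup V] [Module ℂ V] [AddCommGroup A] [Module ℂ A]
  {𝒱 : VertexOperatorAlgebra V}

/-- The vertex operator map `Y₁(v, x) = Y(v ⊗ 𝟏, x)` on a weak `V ⊗ V`-module. -/
def WeakModule.left (S : WeakModule (𝒱.tensor 𝒱) A) : V →ₗ[ℂ] ℤ → Module.End ℂ A :=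
  S.Y ∘ₗ (TensorProduct.mk ℂ V V).flip 𝒱.vac

/-- The vertex operator map `Y₂(v, x) = Y(𝟏 ⊗ v, x)` on a weak `V ⊗ V`-module. -/
def WeakModule.right (S : WeakModule (𝒱.tensor 𝒱) A) : V →ₗ[ℂ] ℤ → Module.End ℂ A :=
  S.Y ∘ₗ TensorProduct.mk ℂ V V 𝒱.vac

/-- The series `⟨φ, Y₁(e^(x₁ L(1)) (-x₁⁻²)^(L(0)) v, x₀) a⟩`. -/
def WeakModule.leftOppSeries (S : WeakModule (𝒱.tensor 𝒱) A) (v : V) (φ : Module.Dual ℂ A) (a : A)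
    (r : ℤ × ℤ) : ℂ :=
  φ (S.left (𝒱.oppVec v r.2) (-r.1 - 1) a)

/-- The series `⟨φ, Y₂ᵒ(v, x) a⟩`, as the sequence of the coefficients of the `x^j`. -/
def WeakModule.rightOppSeries (S : WeakModule (𝒱.tensor 𝒱) A) (v : V) (φ : Module.Dual ℂ A)
    (a : A) (j : ℤ) : ℂ :=
  φ (𝒱.oppMode S.right v (-j - 1) a)

theorem WeakModule.finite_left (S : WeakModule (𝒱.tensor 𝒱) A) (z : ℂ) (v : V)
    (φ : Module.Dual ℂ A) (a : A) (p : ℤ × ℤ) :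
    (Function.support fun r =>
      substInv (deltaX₁SubX₀ z) (p - r) • S.leftOppSeries v φ a r).Finite := by
  have hN : ∀ k : ℤ, ∃ N : ℤ, ∀ n ≥ N, S.left (𝒱.oppVec v k) n a = 0 := fun k =>
    S.isWeakModule.trunc _ a
  choose N hN using hN
  refine ((𝒱.oppVec_finite v).biUnion (t := fun k =>
    (Set.Icc (-N k - 1) p.1) ×ˢ {k}) fun k _ =>
      (Set.finite_Icc _ _).prod (Set.finite_singleton k)).subset fun r hr => ?_
  by_contra hne
  refine hr ?_
  by_cases h0 : 𝒱.oppVec v r.2 = 0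
  · simp [WeakModule.leftOppSeries, h0]
  have h1 : ¬ (r ∈ (Set.Icc (-N r.2 - 1) p.1) ×ˢ {r.2}) := fun h2 =>
    hne (Set.mem_biUnion (show r.2 ∈ _ from h0) h2)
  rw [Set.mem_prod, Set.mem_Icc] at h1
  by_cases h3 : p.1 < r.1
  · have : substInv (deltaX₁SubX₀ z) (p - r) = 0 :=
      deltaX₁SubX₀_neg z _ (by simpa using h3)
    simp [this]
  · have h4 : r.1 < -N r.2 - 1 := by
      by_contra h5
      exact h1 ⟨⟨by omega, by omega⟩, rfl⟩
    simp [WeakModule.leftOppSeries, hN r.2 (-r.1 - 1) (by omega)]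

theorem WeakModule.rightOpp_trunc (S : WeakModule (𝒱.tensor 𝒱) A) (v : V)
    (φ : Module.Dual ℂ A) (a : A) : ∃ N : ℤ, ∀ j ≥ N, S.rightOppSeries v φ a j = 0 := by
  have hN : ∀ k : ℤ, ∃ N : ℤ, ∀ n ≥ N, S.right (𝒱.oppVec v k) n a = 0 := fun k =>
    S.isWeakModule.trunc _ a
  choose N hN using hN
  obtain ⟨K, hK⟩ := ((𝒱.oppVec_finite v).image fun k => N k + 1 + k).bddAbove
  refine ⟨K, fun j hj => ?_⟩
  have hfin (m : ℤ) : (Function.support fun k : ℤ =>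
      S.right (𝒱.oppVec v k) (-m - 2 - k)).Finite :=
    (𝒱.oppVec_finite v).subset fun k hk => by
      intro h0
      exact hk (by simp [h0])
  rw [WeakModule.rightOppSeries, VertexOperatorAlgebra.oppMode,
    finsum_eq_sum_of_support_subset (s := (hfin (-j - 1)).toFinset) _ (by simp),
    LinearMap.sum_apply, Finset.sum_eq_zero, map_zero]
  intro k hk
  by_cases h0 : 𝒱.oppVec v k = 0
  · simp [h0]
  · have := hK (Set.mem_image_of_mem _ (show k ∈ {k | 𝒱.oppVec v k ≠ 0} from h0))
    exact hN k _ (by omega)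

theorem WeakModule.finite_right (S : WeakModule (𝒱.tensor 𝒱) A) (z : ℂ) (v : V)
    (φ : Module.Dual ℂ A) (a : A) (p : ℤ × ℤ) :
    (Function.support fun r =>
      substInv (deltaZSubX₁ z) (p - r) • inX₁ (S.rightOppSeries v φ a) r).Finite :=
  finite_inX₁' (substInv_deltaZSubX₁_above z) (S.rightOpp_trunc v φ a) p

/-- The series
`z⁻¹ δ((x₁⁻¹ - x₀)/z) ⟨φ, Y₁(e^(x₁ L(1)) (-x₁⁻²)^(L(0)) v, x₀) a⟩
  + x₀⁻¹ δ((z - x₁⁻¹)/(-x₀)) ⟨φ, Y₂ᵒ(v, x₁) a⟩`. -/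
def WeakModule.pzSeries (S : WeakModule (𝒱.tensor 𝒱) A) (z : ℂ) (v : V) (φ : Module.Dual ℂ A)
    (a : A) (p : ℤ × ℤ) : ℂ :=
  seriesMul (substInv (deltaX₁SubX₀ z)) (S.leftOppSeries v φ a) p
    + seriesMul (substInv (deltaZSubX₁ z)) (inX₁ (S.rightOppSeries v φ a)) p

theorem WeakModule.pzSeries_add_left (S : WeakModule (𝒱.tensor 𝒱) A) (z : ℂ) (v : V)
    (φ ψ : Module.Dual ℂ A) (a : A) (p : ℤ × ℤ) :
    S.pzSeries z v (φ + ψ) a p = S.pzSeries z v φ a p + S.pzSeries z v ψ a p := by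
  have h1 : S.leftOppSeries v (φ + ψ) a
      = fun r => S.leftOppSeries v φ a r + S.leftOppSeries v ψ a r := rfl
  have h2 : S.rightOppSeries v (φ + ψ) a
      = fun r => S.rightOppSeries v φ a r + S.rightOppSeries v ψ a r := rfl
  rw [pzSeries, h1, h2, inX₁_add, seriesMul_add (S.finite_left ..) (S.finite_left ..),
    seriesMul_add (S.finite_right ..) (S.finite_right ..), pzSeries, pzSeries]
  ring

theorem WeakModule.pzSeries_smul_left (S : WeakModule (𝒱.tensor 𝒱) A) (z : ℂ) (v : V) (c : ℂ)
    (φ : Module.Dual ℂ A) (a : A) (p : ℤ × ℤ) :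
    S.pzSeries z v (c • φ) a p = c • S.pzSeries z v φ a p := by
  have h1 : S.leftOppSeries v (c • φ) a = fun r => c • S.leftOppSeries v φ a r := rfl
  have h2 : S.rightOppSeries v (c • φ) a = fun r => c • S.rightOppSeries v φ a r := rfl
  rw [pzSeries, h1, h2, inX₁_smul, seriesMul_smul, seriesMul_smul, pzSeries, smul_add]

theorem WeakModule.pzSeries_add_right (S : WeakModule (𝒱.tensor 𝒱) A) (z : ℂ) (v : V)
    (φ : Module.Dual ℂ A) (a b : A) (p : ℤ × ℤ) :
    S.pzSeries z v φ (a + b) p = S.pzSeries z v φ a p + S.pzSeries z v φ b p := by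
  have h1 : S.leftOppSeries v φ (a + b)
      = fun r => S.leftOppSeries v φ a r + S.leftOppSeries v φ b r := by
    funext r; simp [leftOppSeries]
  have h2 : S.rightOppSeries v φ (a + b)
      = fun r => S.rightOppSeries v φ a r + S.rightOppSeries v φ b r := by
    funext r; simp [rightOppSeries]
  rw [pzSeries, h1, h2, inX₁_add, seriesMul_add (S.finite_left ..) (S.finite_left ..),
    seriesMul_add (S.finite_right ..) (S.finite_right ..), pzSeries, pzSeries]
  ring

theorem WeakModule.pzSeries_smul_right (S : WeakModule (𝒱.tensor 𝒱) A) (z : ℂ) (v : V) (c : ℂ)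
    (φ : Module.Dual ℂ A) (a : A) (p : ℤ × ℤ) :
    S.pzSeries z v φ (c • a) p = c • S.pzSeries z v φ a p := by
  have h1 : S.leftOppSeries v φ (c • a) = fun r => c • S.leftOppSeries v φ a r := by
    funext r; simp [leftOppSeries]
  have h2 : S.rightOppSeries v φ (c • a) = fun r => c • S.rightOppSeries v φ a r := by
    funext r; simp [rightOppSeries]
  rw [pzSeries, h1, h2, inX₁_smul, seriesMul_smul, seriesMul_smul, pzSeries, smul_add]

/-- The vertex operator map `Y'_{P(z)}` on `A^*`: the mode `vₙ`, which is the coefficient of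
`x^(-n-1)` in `Y'_{P(z)}(v, x)`, where
`⟨Y'_{P(z)}(v, x) φ, a⟩
  = Res_{x₀} z⁻¹ δ((x⁻¹ - x₀)/z) ⟨φ, Y₁(e^(x L(1)) (-x⁻²)^(L(0)) v, x₀) a⟩
    + Res_{x₀} x₀⁻¹ δ((z - x⁻¹)/(-x₀)) ⟨φ, Y₂ᵒ(v, x) a⟩`
and `Res_{x₀}` is the coefficient of `x₀⁻¹`. -/
def WeakModule.pzMode (S : WeakModule (𝒱.tensor 𝒱) A) (z : ℂ) (v : V) (n : ℤ) :
    Module.End ℂ (Module.Dual ℂ A) :=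
  LinearMap.mk₂ ℂ (fun φ a => S.pzSeries z v φ a (-1, -n - 1))
    (fun _ _ _ => S.pzSeries_add_left ..) (fun _ _ _ => S.pzSeries_smul_left ..)
    (fun _ _ _ => S.pzSeries_add_right ..) (fun _ _ _ => S.pzSeries_smul_right ..)

/-- The `P(z)`-compatibility condition for a linear functional `φ` on `A`. -/
structure WeakModule.IsPzCompatible (S : WeakModule (𝒱.tensor 𝒱) A) (z : ℂ)
    (φ : Module.Dual ℂ A) : Prop where
  /-- the `P(z)`-lower truncation condition: `Y'_{P(z)}(v, x) φ` involves only finitely many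
  negative powers of `x` -/
  lower_trunc : ∀ v : V, ∃ N : ℤ, ∀ n ≥ N, S.pzMode z v n φ = 0
  /-- `x₀⁻¹ δ((x₁⁻¹ - z)/x₀) ⟨Y'_{P(z)}(v, x₁) φ, a⟩
  = z⁻¹ δ((x₁⁻¹ - x₀)/z) ⟨φ, Y₁(e^(x₁ L(1)) (-x₁⁻²)^(L(0)) v, x₀) a⟩
    + x₀⁻¹ δ((z - x₁⁻¹)/(-x₀)) ⟨φ, Y₂ᵒ(v, x₁) a⟩` -/
  jacobi : ∀ (v : V) (a : A) (p : ℤ × ℤ),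
    seriesMul (substInv (deltaX₁SubZ z)) (inX₁ fun j => S.pzMode z v (-j - 1) φ a) p
      = seriesMul (substInv (deltaX₁SubX₀ z)) (S.leftOppSeries v φ a) p
        + seriesMul (substInv (deltaZSubX₁ z)) (inX₁ (S.rightOppSeries v φ a)) p

theorem WeakModule.finite_pz (S : WeakModule (𝒱.tensor 𝒱) A) (z : ℂ) {φ : Module.Dual ℂ A}
    (hφ : S.IsPzCompatible z φ) (v : V) (a : A) (p : ℤ × ℤ) :
    (Function.support fun r => substInv (deltaX₁SubZ z) (p - r) •
      inX₁ (fun j => S.pzMode z v (-j - 1) φ a) r).Finite := by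
  obtain ⟨N, hN⟩ := hφ.lower_trunc v
  exact finite_inX₁ (substInv_deltaX₁SubZ_below z)
    ⟨-N - 1, fun j hj => by rw [hN _ (by omega), LinearMap.zero_apply]⟩ p

/-- The subspace of `A^*` of all linear functionals that satisfy the `P(z)`-compatibility
condition. -/
def WeakModule.pzTilde (S : WeakModule (𝒱.tensor 𝒱) A) (z : ℂ) :
    Submodule ℂ (Module.Dual ℂ A) where
  carrier := {φ | S.IsPzCompatible z φ}
  zero_mem' := by
    refine ⟨fun v => ⟨0, fun n _ => map_zero _⟩, fun v a p => ?_⟩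
    have h1 : S.leftOppSeries v 0 a = fun _ => 0 := rfl
    have h2 : S.rightOppSeries v 0 a = fun _ => 0 := rfl
    simp only [map_zero, LinearMap.zero_apply, h1, h2, inX₁_zero, seriesMul_zero, add_zero]
  add_mem' := by
    intro φ ψ hφ hψ
    refine ⟨fun v => ?_, fun v a p => ?_⟩
    · obtain ⟨N, hN⟩ := hφ.lower_trunc v
      obtain ⟨M, hM⟩ := hψ.lower_trunc v
      refine ⟨max N M, fun n hn => ?_⟩
      rw [map_add, hN n (le_trans (le_max_left _ _) hn), hM n (le_trans (le_max_right _ _) hn),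
        add_zero]
    · simp only [map_add, LinearMap.add_apply]
      rw [inX₁_add, seriesMul_add (S.finite_pz z hφ v a p) (S.finite_pz z hψ v a p),
        hφ.jacobi, hψ.jacobi]
      exact (S.pzSeries_add_left z v φ ψ a p).symm
  smul_mem' := by
    intro c φ hφ
    refine ⟨fun v => ?_, fun v a p => ?_⟩
    · obtain ⟨N, hN⟩ := hφ.lower_trunc v
      exact ⟨N, fun n hn => by rw [map_smul, hN n hn, smul_zero]⟩
    · simp only [map_smul, LinearMap.smul_apply]
      rw [inX₁_smul, seriesMul_smul, hφ.jacobi]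
      exact (S.pzSeries_smul_left z v c φ a p).symm

/-- `U` is an (ordinary) `V`-submodule of the weak `V`-module of all linear functionals that
satisfy the `P(z)`-compatibility condition: `U` is a subspace of it that is stable under all modes
of `Y'_{P(z)}`, and the `V`-module `U` is graded by the eigenvalues of `L(0)` with the two grading
restrictions. -/
structure WeakModule.IsOrdinarySubmodule (S : WeakModule (𝒱.tensor 𝒱) A) (z : ℂ)
    (U : Submodule ℂ (Module.Dual ℂ A)) : Prop where
  le : U ≤ S.pzTilde z
  stable : ∀ (v : V) (n : ℤ), ∀ φ ∈ U, S.pzMode z v n φ ∈ U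
  isOrdinary : IsOrdinaryGrading ((S.pzMode z 𝒱.vir 1).restrict (stable 𝒱.vir 1))

/-- `T'_{P(z)}(A)`: the sum of all (ordinary) `V`-submodules of the weak `V`-module of all
linear functionals that satisfy the `P(z)`-compatibility condition. -/
def WeakModule.pzDual (S : WeakModule (𝒱.tensor 𝒱) A) (z : ℂ) :
    Submodule ℂ (Module.Dual ℂ A) :=
  sSup {U | S.IsOrdinarySubmodule z U}

end Pz

/-- `Hom_V(M, U)`, where `U` is a subspace of `N`: the space of linear maps `G : M → U` with
`G (Y_M(v, x) m) = Y_N(v, x) G(m)`. -/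
def vertexHom {V M N : Type*} [AddCommGroup V] [Module ℂ V] [AddCommGroup M] [Module ℂ M]
    [AddCommGroup N] [Module ℂ N] (YM : V → ℤ → Module.End ℂ M) (YN : V → ℤ → Module.End ℂ N)
    (U : Submodule ℂ N) : Submodule ℂ (M →ₗ[ℂ] U) where
  carrier := {G | ∀ (v : V) (n : ℤ) (m : M), (G (YM v n m) : N) = YN v n (G m : N)}
  zero_mem' := by intro v n m; simp
  add_mem' := by intro F G hF hG v n m; simp [hF v n m, hG v n m]
  smul_mem' := by intro c G hG v n m; simp [hG v n m]

/-! ### Contragredient module and completion of a module -/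

section Completion

variable {V W : Type*} [AddCommGroup V] [Module ℂ V] [AddCommGroup W] [Module ℂ W]
  {𝒱 : VertexOperatorAlgebra V}

/-- The homogeneous subspace `W_(h)` of a module. -/
abbrev OrdinaryModule.weight (P : OrdinaryModule 𝒱.toVertexData W) (h : ℂ) : Submodule ℂ W :=
  (P.Y 𝒱.vir 1).eigenspace h

/-- The restricted dual `W' = ∐_h W_(h)^*`, realised as the space of those linear functionals
on `W` that vanish on all but finitely many of the `W_(h)`. -/
def OrdinaryModule.restrictedDual (P : OrdinaryModule 𝒱.toVertexData W) :
    Submodule ℂ (Module.Dual ℂ W) where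
  carrier := {f | {h : ℂ | ∃ w ∈ P.weight h, f w ≠ 0}.Finite}
  zero_mem' := by simp
  add_mem' := by
    intro f g hf hg
    refine (Set.Finite.union hf hg).subset ?_
    rintro h ⟨w, hw, hne⟩
    by_contra hcon
    simp only [Set.mem_union, Set.mem_ofPred_eq, not_or, not_exists, not_and, not_not] at hcon
    exact hne (by rw [LinearMap.add_apply, hcon.1 w hw, hcon.2 w hw, add_zero])
  smul_mem' := by
    intro c f hf
    refine Set.Finite.subset hf ?_
    rintro h ⟨w, hw, hne⟩
    exact ⟨w, hw, fun h0 => hne (by rw [LinearMap.smul_apply, h0, smul_zero])⟩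

theorem OrdinaryModule.comp_mode_mem (P : OrdinaryModule 𝒱.toVertexData W) {f : Module.Dual ℂ W}
    (hf : f ∈ P.restrictedDual) (u : V) (n : ℤ) : f ∘ₗ P.Y u n ∈ P.restrictedDual := by
  induction u using 𝒱.homogeneous_induction with
  | hom k u hu =>
    refine (Set.Finite.preimage (f := fun h : ℂ => h + k - n - 1) ?_ hf).subset ?_
    · intro a _ b _ hab
      simpa using hab
    · rintro h ⟨w, hw, hne⟩
      exact ⟨P.Y u n w, P.isWeakModule.mode_mem hu hw n, hne⟩
  | zero =>
    rw [map_zero, Pi.zero_apply, LinearMap.comp_zero]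
    exact Submodule.zero_mem _
  | add u u' hu hu' =>
    rw [map_add, Pi.add_apply, LinearMap.comp_add]
    exact Submodule.add_mem _ hu hu'

theorem OrdinaryModule.comp_oppMode_mem (P : OrdinaryModule 𝒱.toVertexData W) (v : V) (n : ℤ) :
    ∀ f ∈ P.restrictedDual, (𝒱.oppMode P.Y v n).dualMap f ∈ P.restrictedDual := by
  unfold VertexOperatorAlgebra.oppMode
  refine finsum_induction
    (fun T : Module.End ℂ W => ∀ f ∈ P.restrictedDual, T.dualMap f ∈ P.restrictedDual) ?_ ?_ ?_
  · intro f _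
    have : (0 : Module.End ℂ W).dualMap f = 0 := by ext; simp
    rw [this]
    exact Submodule.zero_mem _
  · intro S T hS hT f hf
    have : (S + T).dualMap f = S.dualMap f + T.dualMap f := by ext; simp
    rw [this]
    exact Submodule.add_mem _ (hS f hf) (hT f hf)
  · intro k f hf
    exact P.comp_mode_mem hf _ _

/-- The vertex operator map of the contragredient module `W'`, as a family of modes:
`⟨Y'(v, x) f, w⟩ = ⟨f, Yᵒ(v, x) w⟩`. -/
def OrdinaryModule.dualMode (P : OrdinaryModule 𝒱.toVertexData W) (v : V) (n : ℤ) :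
    Module.End ℂ P.restrictedDual :=
  (𝒱.oppMode P.Y v n).dualMap.restrict (P.comp_oppMode_mem v n)

/-- The formal completion `∏_h W_(h)`. -/
abbrev OrdinaryModule.Completion (P : OrdinaryModule 𝒱.toVertexData W) : Type _ :=
  ∀ h : ℂ, P.weight h

theorem OrdinaryModule.pairing_finite (P : OrdinaryModule 𝒱.toVertexData W)
    (f : P.restrictedDual) (w : P.Completion) :
    (Function.support fun h : ℂ => (f : Module.Dual ℂ W) (w h : W)).Finite :=
  Set.Finite.subset f.2 fun h hh => ⟨w h, (w h).2, hh⟩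

/-- The natural pairing of `W'` with the completion of `W`. -/
def OrdinaryModule.pairing (P : OrdinaryModule 𝒱.toVertexData W) :
    P.restrictedDual →ₗ[ℂ] P.Completion →ₗ[ℂ] ℂ :=
  LinearMap.mk₂ ℂ (fun f w => ∑ᶠ h : ℂ, (f : Module.Dual ℂ W) (w h : W))
    (fun f g w => by
      rw [← finsum_add_distrib (P.pairing_finite f w) (P.pairing_finite g w)]; simp)
    (fun c f w => by rw [smul_finsum]; simp)
    (fun f w w' => by
      rw [← finsum_add_distrib (P.pairing_finite f w) (P.pairing_finite f w')]; simp)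
    (fun c f w => by rw [smul_finsum]; simp)

/-- The extension of the mode `vₙ` from `W` to the completion: its component in `W_(k)` is
the (finite) sum over `h` of the `W_(k)`-components of `vₙ w_h`. -/
def OrdinaryModule.extMode (P : OrdinaryModule 𝒱.toVertexData W) (v : V) (n : ℤ)
    (w : P.Completion) : P.Completion := fun k =>
  ∑ᶠ h : ℂ, wtProj (P.Y 𝒱.vir 1) P.isOrdinary.iSup_eq_top k (P.Y v n (w h : W))

theorem OrdinaryModule.extMode_finite (P : OrdinaryModule 𝒱.toVertexData W) (v : V) (n : ℤ)
    (k : ℂ) : {h : ℂ | ∃ w ∈ P.weight h,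
      wtProj (P.Y 𝒱.vir 1) P.isOrdinary.iSup_eq_top k (P.Y v n w) ≠ 0}.Finite := by
  induction v using 𝒱.homogeneous_induction with
  | hom m u hu =>
    refine (Set.finite_singleton (k - m + n + 1)).subset ?_
    rintro h ⟨w, hw, hne⟩
    by_contra hcon
    refine hne (wtProj_of_ne _ _ (fun h1 => hcon ?_) (P.isWeakModule.mode_mem hu hw n))
    rw [Set.mem_singleton_iff, ← h1]
    ring
  | zero => simp
  | add u u' hu hu' =>
    refine (hu.union hu').subset ?_
    rintro h ⟨w, hw, hne⟩
    by_contra hcon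
    simp only [Set.mem_union, Set.mem_ofPred_eq, not_or, not_exists, not_and, not_not] at hcon
    exact hne (by
      rw [map_add, Pi.add_apply, LinearMap.add_apply, map_add, hcon.1 w hw, hcon.2 w hw,
        add_zero])

theorem OrdinaryModule.extMode_add (P : OrdinaryModule 𝒱.toVertexData W) (v : V) (n : ℤ)
    (w w' : P.Completion) : P.extMode v n (w + w') = P.extMode v n w + P.extMode v n w' := by
  funext k
  have hfin (w : P.Completion) : (Function.support fun h : ℂ =>
      wtProj (P.Y 𝒱.vir 1) P.isOrdinary.iSup_eq_top k (P.Y v n (w h : W))).Finite :=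
    (P.extMode_finite v n k).subset fun h hh => ⟨w h, (w h).2, hh⟩
  rw [Pi.add_apply, extMode, extMode, extMode, ← finsum_add_distrib (hfin w) (hfin w')]
  simp

theorem OrdinaryModule.extMode_smul (P : OrdinaryModule 𝒱.toVertexData W) (v : V) (n : ℤ)
    (c : ℂ) (w : P.Completion) : P.extMode v n (c • w) = c • P.extMode v n w := by
  funext k
  rw [Pi.smul_apply, extMode, extMode, smul_finsum]
  simp

/-- The `W_(k)`-component of `Y(v, x) w`, for `w` in the completion, is a series in `x` that is
truncated from above, uniformly in `w`. -/
theorem OrdinaryModule.extMode_trunc (P : OrdinaryModule 𝒱.toVertexData W) (v : V) (k : ℂ) :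
    ∃ J : ℤ, ∀ j ≥ J, ∀ w : P.Completion, P.extMode v (-j - 1) w k = 0 := by
  suffices H : ∃ J : ℤ, ∀ j ≥ J, ∀ h : ℂ, ∀ w ∈ P.weight h,
      wtProj (P.Y 𝒱.vir 1) P.isOrdinary.iSup_eq_top k (P.Y v (-j - 1) w) = 0 by
    obtain ⟨J, hJ⟩ := H
    exact ⟨J, fun j hj w => finsum_eq_zero_of_forall_eq_zero fun h => hJ j hj h _ (w h).2⟩
  obtain ⟨r, hr⟩ := P.isOrdinary.lower_trunc
  induction v using 𝒱.homogeneous_induction with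
  | hom m u hu =>
    refine ⟨⌊k.re - m - r⌋ + 1, fun j hj h w hw => ?_⟩
    by_cases hk : h + m - ((-j - 1 : ℤ) : ℂ) - 1 = k
    · have hre : h.re < r := by
        have h1 := congrArg Complex.re hk
        push_cast at h1
        simp at h1
        have h2 : k.re - m - r < j :=
          lt_of_lt_of_le (Int.lt_floor_add_one _) (by exact_mod_cast hj)
        linarith
      have : w = 0 := by simpa [OrdinaryModule.weight, hr h hre] using hw
      simp [this]
    · exact wtProj_of_ne _ _ hk (P.isWeakModule.mode_mem hu hw _)
  | zero => exact ⟨0, by simp⟩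
  | add u u' hu hu' =>
    obtain ⟨J, hJ⟩ := hu
    obtain ⟨J', hJ'⟩ := hu'
    refine ⟨max J J', fun j hj h w hw => ?_⟩
    rw [map_add, Pi.add_apply, LinearMap.add_apply, map_add,
      hJ j (le_trans (le_max_left _ _) hj) h w hw,
      hJ' j (le_trans (le_max_right _ _) hj) h w hw, add_zero]

/-! ### `P(z)`-intertwining maps -/

variable {A : Type*} [AddCommGroup A] [Module ℂ A]

/-- `F : A → ∏_h W_(h)` is a `P(z)`-intertwining map:
`x₀⁻¹ δ((x₁ - z)/x₀) Y(v, x₁) F(a) - x₀⁻¹ δ((z - x₁)/(-x₀)) F(Y₂(v, x₁) a)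
  = z⁻¹ δ((x₁ - x₀)/z) F(Y₁(v, x₀) a)`,
as an identity of series with coefficients in the completion; the coefficients are computed
component by component. -/
def IsPzIntertwining (S : WeakModule (𝒱.tensor 𝒱) A) (P : OrdinaryModule 𝒱.toVertexData W)
    (z : ℂ) (F : A →ₗ[ℂ] P.Completion) : Prop :=
  ∀ (v : V) (a : A) (h : ℂ) (p : ℤ × ℤ),
    seriesMul (deltaX₁SubZ z) (inX₁ fun j => P.extMode v (-j - 1) (F a) h) p
      - seriesMul (deltaZSubX₁ z) (inX₁ fun j => F (S.right v (-j - 1) a) h) p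
      = seriesMul (deltaX₁SubX₀ z) (inX₀ fun i => F (S.left v (-i - 1) a) h) p

/-- The space `M_{P(z)}(A, W)` of all `P(z)`-intertwining maps. -/
def pzIntertwining (S : WeakModule (𝒱.tensor 𝒱) A) (P : OrdinaryModule 𝒱.toVertexData W)
    (z : ℂ) : Submodule ℂ (A →ₗ[ℂ] P.Completion) where
  carrier := {F | IsPzIntertwining S P z F}
  zero_mem' := by
    intro v a h p
    have h0 : ∀ n, P.extMode v n 0 h = 0 := fun n => by
      have := P.extMode_smul v n 0 0
      rw [zero_smul, zero_smul] at this
      rw [this, Pi.zero_apply]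
    simp only [LinearMap.zero_apply, Pi.zero_apply, h0, inX₁_zero, inX₀_zero, seriesMul_zero,
      sub_zero]
  add_mem' := by
    intro F G hF hG v a h p
    have e1 (F : A →ₗ[ℂ] P.Completion) := finite_inX₁' (deltaX₁SubZ_above z)
      (g := fun j => P.extMode v (-j - 1) (F a) h)
      (by obtain ⟨J, hJ⟩ := P.extMode_trunc v h; exact ⟨J, fun j hj => hJ j hj _⟩) p
    have e2 (F : A →ₗ[ℂ] P.Completion) := finite_inX₁ (deltaZSubX₁_below z)
      (g := fun j => F (S.right v (-j - 1) a) h)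
      (by
        obtain ⟨N, hN⟩ := S.isWeakModule.trunc (𝒱.vac ⊗ₜ v) a
        refine ⟨-N - 1, fun j hj => ?_⟩
        have : S.right v (-j - 1) a = 0 := hN _ (by omega)
        simp only [this, map_zero, Pi.zero_apply]) p
    have e3 (F : A →ₗ[ℂ] P.Completion) := finite_inX₀ (deltaX₁SubX₀_neg z)
      (g := fun j => F (S.left v (-j - 1) a) h)
      (by
        obtain ⟨N, hN⟩ := S.isWeakModule.trunc (v ⊗ₜ 𝒱.vac) a
        refine ⟨-N - 1, fun j hj => ?_⟩
        have : S.left v (-j - 1) a = 0 := hN _ (by omega)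
        simp only [this, map_zero, Pi.zero_apply]) p
    simp only [LinearMap.add_apply, Pi.add_apply, P.extMode_add, inX₁_add, inX₀_add]
    rw [seriesMul_add (e1 F) (e1 G), seriesMul_add (e2 F) (e2 G), seriesMul_add (e3 F) (e3 G),
      ← hF v a h p, ← hG v a h p]
    abel
  smul_mem' := by
    intro c F hF v a h p
    simp only [LinearMap.smul_apply, Pi.smul_apply, P.extMode_smul, inX₁_smul, inX₀_smul,
      seriesMul_smul]
    rw [← hF v a h p, smul_sub]

/-- The restriction of the dual map `F^*` to `W'`: `⟨F^*(f), a⟩ = ⟨f, F(a)⟩`. -/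
def dualRestrict (P : OrdinaryModule 𝒱.toVertexData W) (F : A →ₗ[ℂ] P.Completion) :
    P.restrictedDual →ₗ[ℂ] Module.Dual ℂ A :=
  P.pairing.compl₂ F

end Completion

end

/-! Everything rests on transposition between $W'$ and $\overline W$. Since $W'$ separates the
points of $\overline W$, the intertwining identity for $F$ holds exactly when its pairing with every
$f\in W'$ does; this pairing is an identity between scalar series, for each $v$, $a$ and $f$.

In that identity put $e^{x_1L(1)}(-x_1^{-2})^{L(0)}v$ for $v$ and $x_1^{-1}$ for $x_1$. The
definition of the contragredient action turns the first term into $\langle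
F^*(Y'(v,x_1)f),a\rangle$, and the other two become the right side of the compatibility condition
for $F^*(f)$. No information is lost: on a vector of weight $n$ the substitution is
$(-1)^nx_1^{-2n}$ plus terms of lower weight, and the weights of $V$ are bounded below, so it can be
undone by induction on the weight (`pzDefect_eq_zero_iff`). This gives `isPzIntertwining_iff`, which
is the compatibility identity with $F^*(Y'(v,x_1)f)$ in place of $Y'_{P(z)}(v,x_1)F^*(f)$.

Taking the residue in $x_0$ of that identity shows that these two agree. Hence $F^*$ is a
homomorphism; lower truncation comes from $W'$, and the rest of the compatibility condition is the
identity itself. Conversely, a homomorphism into compatible functionals satisfies the identity at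
once.

For the isomorphism, $W'$ has an ordinary grading, hence so does its image under a homomorphism,
which therefore lies in $T'_{P(z)}(A)$. Injectivity of $F\mapsto F^*$ is again separation of points,
and surjectivity is reflexivity of the finite-dimensional spaces $W_{(h)}$. -/

noncomputable section

/-! ### Projections onto weight spaces -/

section WeightSpaces

variable {M : Type*} [AddCommGroup M] [Module ℂ M]

theorem wtProj_of_mem (T : Module.End ℂ M) (hT : ⨆ μ : ℂ, T.eigenspace μ = ⊤) {μ : ℂ} {x : M}
    (hx : x ∈ T.eigenspace μ) : (wtProj T hT μ x : M) = x := by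
  have h1 : (LinearEquiv.ofBijective (DirectSum.coeLinearMap fun μ : ℂ => T.eigenspace μ)
      (bijective_coeLinearMap_eigenspace T hT)).symm x
      = DirectSum.lof ℂ ℂ (fun μ : ℂ => T.eigenspace μ) μ ⟨x, hx⟩ := by
    rw [LinearEquiv.symm_apply_eq, LinearEquiv.ofBijective_apply, DirectSum.coeLinearMap_lof]
  rw [wtProj, LinearMap.comp_apply, LinearEquiv.coe_coe, h1, DirectSum.component.lof_self]

theorem finite_support_wtProj (T : Module.End ℂ M) (hT : ⨆ μ : ℂ, T.eigenspace μ = ⊤) (x : M) :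
    (Function.support fun μ : ℂ => (wtProj T hT μ x : M)).Finite :=
  (wtProj_finite T hT x).subset fun μ hμ h0 => hμ (by simp [h0])

theorem weight_induction (T : Module.End ℂ M) (hT : ⨆ μ : ℂ, T.eigenspace μ = ⊤)
    {P : M → Prop} (x : M) (hom : ∀ μ, ∀ x ∈ T.eigenspace μ, P x) (zero : P 0)
    (add : ∀ x y, P x → P y → P (x + y)) : P x :=
  Submodule.iSup_induction (fun μ : ℂ => T.eigenspace μ) (motive := P)
    (hT.symm ▸ Submodule.mem_top) hom zero add

theorem finsum_wtProj (T : Module.End ℂ M) (hT : ⨆ μ : ℂ, T.eigenspace μ = ⊤) (x : M) :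
    ∑ᶠ μ : ℂ, (wtProj T hT μ x : M) = x := by
  induction x using weight_induction T hT with
  | hom μ x hx =>
    rw [finsum_eq_single _ μ, wtProj_of_mem T hT hx]
    intro ν hν
    rw [wtProj_of_ne T hT hν.symm hx, Submodule.coe_zero]
  | zero => simp
  | add x y hx hy =>
    simp only [map_add, Submodule.coe_add]
    rw [finsum_add_distrib (finite_support_wtProj T hT x) (finite_support_wtProj T hT y), hx, hy]

variable {N : Type*} [AddCommGroup N] [Module ℂ N]

theorem map_mem_eigenspace {T : Module.End ℂ M} {T' : Module.End ℂ N} {G : M →ₗ[ℂ] N}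
    (hG : ∀ x, G (T x) = T' (G x)) {μ : ℂ} {x : M} (hx : x ∈ T.eigenspace μ) :
    G x ∈ T'.eigenspace μ := by
  rw [Module.End.mem_eigenspace_iff] at hx ⊢
  rw [← hG, hx, map_smul]

/-- A homomorphic image of a space with an ordinary grading has an ordinary grading. -/
theorem IsOrdinaryGrading.of_surjective {T : Module.End ℂ M} {T' : Module.End ℂ N}
    (h : IsOrdinaryGrading T) {G : M →ₗ[ℂ] N} (hG : ∀ x, G (T x) = T' (G x))
    (hs : Function.Surjective G) : IsOrdinaryGrading T' := by
  have hT := h.iSup_eq_top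
  have htop : ⨆ μ : ℂ, T'.eigenspace μ = ⊤ := by
    rw [eq_top_iff]
    rintro y -
    obtain ⟨x, rfl⟩ := hs y
    induction x using weight_induction T hT with
    | hom μ x hx => exact Submodule.mem_iSup_of_mem μ (map_mem_eigenspace hG hx)
    | zero => simp
    | add x y hx hy => rw [map_add]; exact add_mem hx hy
  -- `G` carries eigenvectors to eigenvectors with the same eigenvalue, so it commutes with the
  -- projections. An eigenvector of `T'` then lifts to an eigenvector of `T`: project any preimage.
  -- Both grading restrictions pass to the image this way.
  have hproj (μ : ℂ) (x : M) : (wtProj T' htop μ (G x) : N) = G (wtProj T hT μ x) := by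
    induction x using weight_induction T hT with
    | hom ν x hx =>
      by_cases hν : ν = μ
      · subst hν
        rw [wtProj_of_mem T hT hx, wtProj_of_mem T' htop (map_mem_eigenspace hG hx)]
      · rw [wtProj_of_ne T hT hν hx, wtProj_of_ne T' htop hν (map_mem_eigenspace hG hx)]
        simp
    | zero => simp
    | add x y hx hy => simp [hx, hy]
  have hle (μ : ℂ) : T'.eigenspace μ ≤ (T.eigenspace μ).map G := by
    intro y hy
    obtain ⟨x, rfl⟩ := hs y
    exact ⟨wtProj T hT μ x, (wtProj T hT μ x).2, by rw [← hproj, wtProj_of_mem T' htop hy]⟩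
  refine ⟨htop, fun μ => ?_, ?_⟩
  · have := h.finite_dimensional μ
    exact Submodule.finiteDimensional_of_le (hle μ)
  · obtain ⟨r, hr⟩ := h.lower_trunc
    refine ⟨r, fun μ hμ => ?_⟩
    have := hle μ
    rwa [hr μ hμ, Submodule.map_bot, le_bot_iff] at this

end WeightSpaces

/-! ### Formal calculus -/

section FormalCalculus

theorem finsum_eq_finsum_comp {α β M : Type*} [AddCommMonoid M] {f : β → M} {e : α → β}
    (he : Function.Injective e) (hf : ∀ b ∉ Set.range e, f b = 0) :
    ∑ᶠ b, f b = ∑ᶠ a, f (e a) := by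
  rw [← finsum_mem_range he]
  refine finsum_congr fun b => ?_
  by_cases hb : b ∈ Set.range e
  · simp [hb]
  · simp [hb, hf b hb]

theorem seriesMul_inX₁ {M : Type*} [AddCommGroup M] [Module ℂ M] (D : ℤ × ℤ → ℂ) (g : ℤ → M)
    (p : ℤ × ℤ) : seriesMul D (inX₁ g) p = ∑ᶠ j : ℤ, D (p.1, p.2 - j) • g j := by
  rw [seriesMul, finsum_eq_finsum_comp (e := fun j : ℤ => ((0, j) : ℤ × ℤ))]
  · refine finsum_congr fun j => ?_
    rw [show p - (0, j) = (p.1, p.2 - j) by ext <;> simp]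
    simp [inX₁]
  · intro i j h
    simpa using h
  · rintro ⟨i, j⟩ h
    have : i ≠ 0 := fun h0 => h ⟨j, by simp [h0]⟩
    simp [inX₁, this]

theorem map_seriesMul {M N : Type*} [AddCommGroup M] [Module ℂ M] [AddCommGroup N] [Module ℂ N]
    (L : M →ₗ[ℂ] N) {D : ℤ × ℤ → ℂ} {f : ℤ × ℤ → M} {p : ℤ × ℤ}
    (hf : (Function.support fun r => D (p - r) • f r).Finite) :
    L (seriesMul D f p) = seriesMul D (fun r => L (f r)) p := by
  rw [seriesMul, map_finsum L hf, seriesMul]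
  simp only [map_smul]

theorem map_inX₀ {M N : Type*} [AddCommGroup M] [Module ℂ M] [AddCommGroup N] [Module ℂ N]
    (L : M →ₗ[ℂ] N) (g : ℤ → M) : (fun r => L (inX₀ g r)) = inX₀ fun i => L (g i) := by
  funext r
  simp only [inX₀]
  split_ifs <;> simp

theorem map_inX₁ {M N : Type*} [AddCommGroup M] [Module ℂ M] [AddCommGroup N] [Module ℂ N]
    (L : M →ₗ[ℂ] N) (g : ℤ → M) : (fun r => L (inX₁ g r)) = inX₁ fun i => L (g i) := by
  funext r
  simp only [inX₁]
  split_ifs <;> simp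

/-- The residue in `x₀` of `x₀⁻¹ δ((x₁⁻¹ - z)/x₀) g(x₁)` is `g(x₁)`. -/
theorem seriesMul_substInv_deltaX₁SubZ_residue (z : ℂ) (g : ℤ → ℂ) (j : ℤ) :
    seriesMul (substInv (deltaX₁SubZ z)) (inX₁ g) (-1, j) = g j := by
  rw [seriesMul_inX₁, finsum_eq_single _ j]
  · simp [substInv, deltaX₁SubZ]
  · intro i hi
    -- The exponent $-1$ of $x_0$ selects $n=0$, and $(x_1^{-1}-z)^0=1$: every binomial coefficient
    -- $\binom 0i$ with $i>0$ vanishes.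
    by_cases h : -(j - i) ≤ 0
    · have : 0 < (0 - -(j - i)).toNat := by omega
      simp only [substInv, deltaX₁SubZ]
      rw [if_pos (by omega)]
      simp only [neg_neg, sub_self]
      rw [Ring.choose_zero_pos ℤ this]
      simp
    · simp only [substInv, deltaX₁SubZ]
      rw [if_neg (by omega), zero_smul]

/-! ### The substitution of opposite vectors and inversion of $x_1$ -/

variable {V : Type*} [AddCommGroup V] [Module ℂ V]

/-- The coefficients of `x₀⁻¹ δ((x₁ - z)/x₀) α(u, x₁) - x₀⁻¹ δ((z - x₁)/(-x₀)) β(u, x₁)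
  - z⁻¹ δ((x₁ - x₀)/z) γ(u, x₀)`. -/
def pzDefect (z : ℂ) {M : Type*} [AddCommGroup M] [Module ℂ M] (α β γ : V →ₗ[ℂ] ℤ → M)
    (u : V) (p : ℤ × ℤ) : M :=
  seriesMul (deltaX₁SubZ z) (inX₁ (α u)) p - seriesMul (deltaZSubX₁ z) (inX₁ (β u)) p
    - seriesMul (deltaX₁SubX₀ z) (inX₀ (γ u)) p

/-- The coefficients of `α(e^(x L(1)) (-x⁻²)^(L(0)) v, x⁻¹)`. -/
def oppSeries (𝒱 : VertexOperatorAlgebra V) (α : V →ₗ[ℂ] ℤ → ℂ) (v : V) (j : ℤ) : ℂ :=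
  ∑ᶠ k : ℤ, α (𝒱.oppVec v k) (k - j)

/-- The series obtained from `pzDefect` by replacing `u` by `e^(x₁ L(1)) (-x₁⁻²)^(L(0)) v` and
`x₁` by `x₁⁻¹`. -/
def pzOppDefect (𝒱 : VertexOperatorAlgebra V) (z : ℂ) (α β γ : V →ₗ[ℂ] ℤ → ℂ)
    (v : V) (p : ℤ × ℤ) : ℂ :=
  seriesMul (substInv (deltaX₁SubZ z)) (inX₁ (oppSeries 𝒱 α v)) p
    - seriesMul (substInv (deltaZSubX₁ z)) (inX₁ (oppSeries 𝒱 β v)) p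
    - seriesMul (substInv (deltaX₁SubX₀ z)) (fun r => γ (𝒱.oppVec v r.2) r.1) p

theorem finite_support_comp_of_inX₁ {M : Type*} [AddCommGroup M] [Module ℂ M]
    {D : ℤ × ℤ → ℂ} {g : ℤ → M} {p : ℤ × ℤ}
    (h : (Function.support fun r => D (p - r) • inX₁ g r).Finite) :
    (Function.support fun j : ℤ => D (p.1, p.2 - j) • g j).Finite := by
  refine (h.preimage (f := fun j : ℤ => ((0, j) : ℤ × ℤ)) ?_).subset fun j hj => ?_
  · intro i _ j _ h
    simpa using h
  · rw [Set.mem_preimage, Function.mem_support,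
      show p - (0, j) = (p.1, p.2 - j) by ext <;> simp]
    simpa [inX₁] using hj

theorem oppSeries_eq_sum (𝒱 : VertexOperatorAlgebra V) (α : V →ₗ[ℂ] ℤ → ℂ) (v : V) (j : ℤ) :
    oppSeries 𝒱 α v j
      = ∑ k ∈ (𝒱.oppVec_finite v).toFinset, α (𝒱.oppVec v k) (k - j) := by
  refine finsum_eq_sum_of_support_subset _ fun k hk => ?_
  simp only [Set.Finite.coe_toFinset, Set.mem_ofPred_eq]
  intro h0
  simp [h0] at hk

/-- The substituted vector is a Laurent polynomial, so the product splits into finitely many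
products, one for each power $x_1^k$. Inversion negates the exponent of $x_1$ and the factor $x_1^k$
shifts it, which together give the index `k - p.2`. The hypothesis `hα` justifies exchanging the two
sums. -/
theorem seriesMul_inX₁_oppSeries (𝒱 : VertexOperatorAlgebra V) {D : ℤ × ℤ → ℂ}
    {α : V →ₗ[ℂ] ℤ → ℂ}
    (hα : ∀ u p, (Function.support fun r => D (p - r) • inX₁ (α u) r).Finite)
    (v : V) (p : ℤ × ℤ) :
    seriesMul (substInv D) (inX₁ (oppSeries 𝒱 α v)) p
      = ∑ k ∈ (𝒱.oppVec_finite v).toFinset,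
          seriesMul D (inX₁ (α (𝒱.oppVec v k))) (p.1, k - p.2) := by
  have key (k : ℤ) : ∀ j : ℤ, substInv D (p.1, p.2 - j) • α (𝒱.oppVec v k) (k - j)
      = (fun i : ℤ => D (p.1, k - p.2 - i) • α (𝒱.oppVec v k) i) (Equiv.subLeft k j) := by
    intro j
    simp only [substInv, Equiv.subLeft_apply]
    congr 3
    ring
  rw [seriesMul_inX₁]
  simp only [oppSeries_eq_sum, Finset.smul_sum, seriesMul_inX₁]
  rw [finsum_sum_comm]
  · refine Finset.sum_congr rfl fun k _ => ?_
    exact (finsum_congr (key k)).trans (finsum_comp_equiv (Equiv.subLeft k)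
      (f := fun i : ℤ => D (p.1, k - p.2 - i) • α (𝒱.oppVec v k) i))
  · intro k _
    simp only [key]
    refine ((finite_support_comp_of_inX₁ (hα (𝒱.oppVec v k) (p.1, k - p.2))).preimage
      (Equiv.subLeft k).injective.injOn).subset fun j hj => hj

theorem seriesMul_oppVec (𝒱 : VertexOperatorAlgebra V) {D : ℤ × ℤ → ℂ} {γ : V →ₗ[ℂ] ℤ → ℂ}
    (hγ : ∀ u p, (Function.support fun r => D (p - r) • inX₀ (γ u) r).Finite)
    (v : V) (p : ℤ × ℤ) :
    seriesMul (substInv D) (fun r => γ (𝒱.oppVec v r.2) r.1) p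
      = ∑ k ∈ (𝒱.oppVec_finite v).toFinset,
          seriesMul D (inX₀ (γ (𝒱.oppVec v k))) (p.1, k - p.2) := by
  have key (k : ℤ) : ∀ r : ℤ × ℤ,
      substInv D (p - r) • (if r.2 = k then γ (𝒱.oppVec v k) r.1 else 0)
      = (fun s : ℤ × ℤ => D ((p.1, k - p.2) - s) • inX₀ (γ (𝒱.oppVec v k)) s)
          (Equiv.prodCongr (Equiv.refl ℤ) (Equiv.subRight k) r) := by
    intro r
    by_cases h : r.2 = k
    · have : (p.1, k - p.2) - Prod.map id (⇑(Equiv.subRight k)) r = (p.1 - r.1, k - p.2) := by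
        ext <;> simp [h]
      simp [substInv, inX₀, h, this]
    · simp [inX₀, h, sub_eq_zero]
  -- Here $x_1$ occurs only through the coefficients of the substituted vector. Sorting by its
  -- exponent $k$ leaves, for each $k$, a series in $x_0$ times $x_1^k$.
  have hsum (r : ℤ × ℤ) : γ (𝒱.oppVec v r.2) r.1 = ∑ k ∈ (𝒱.oppVec_finite v).toFinset,
      if r.2 = k then γ (𝒱.oppVec v k) r.1 else 0 := by
    rw [Finset.sum_ite_eq]
    split_ifs with h
    · rfl
    · have : 𝒱.oppVec v r.2 = 0 := by simpa using h
      simp [this]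
  rw [seriesMul]
  simp only [hsum, Finset.smul_sum]
  rw [finsum_sum_comm]
  · refine Finset.sum_congr rfl fun k _ => ?_
    exact (finsum_congr (key k)).trans
      (finsum_comp_equiv (Equiv.prodCongr (Equiv.refl ℤ) (Equiv.subRight k))
        (f := fun s : ℤ × ℤ => D ((p.1, k - p.2) - s) • inX₀ (γ (𝒱.oppVec v k)) s))
  · intro k _
    simp only [key]
    refine ((hγ (𝒱.oppVec v k) (p.1, k - p.2)).preimage
      (Equiv.prodCongr (Equiv.refl ℤ) (Equiv.subRight k)).injective.injOn).subset fun j hj => hj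

/-- `v ↦ e^(x L(1)) (-x⁻²)^(L(0)) v` for homogeneous vectors. -/
theorem VertexOperatorAlgebra.oppVec_of_mem (𝒱 : VertexOperatorAlgebra V) {n : ℤ} {v : V}
    (hv : v ∈ (𝒱.Y 𝒱.vir 1).eigenspace (n : ℂ)) (k : ℤ) :
    𝒱.oppVec v k = if 0 ≤ 2 * n + k then
      ((-1 : ℂ) ^ n / ((2 * n + k).toNat.factorial : ℂ)) •
        ((𝒱.Y 𝒱.vir 2) ^ (2 * n + k).toNat) v else 0 := by
  rw [oppVec, finsum_eq_single _ n, wtProj_of_mem _ _ hv]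
  intro m hm
  rw [wtProj_of_ne _ _ (by exact_mod_cast hm.symm) hv]
  simp

/-- The families `α`, `β`, `γ` satisfy the truncation conditions under which all products in
`pzDefect` exist. -/
structure PzTruncated {M : Type*} [AddCommGroup M] [Module ℂ M] (α β γ : V →ₗ[ℂ] ℤ → M) :
    Prop where
  fst : ∀ u, ∃ N : ℤ, ∀ i ≥ N, α u i = 0
  snd : ∀ u, ∃ N : ℤ, ∀ i ≤ N, β u i = 0
  trd : ∀ u, ∃ N : ℤ, ∀ i ≤ N, γ u i = 0

/-! ### Linearity of the defect, and invertibility of the substitution -/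

variable {M : Type*} [AddCommGroup M] [Module ℂ M]

theorem pzDefect_add (z : ℂ) {α β γ : V →ₗ[ℂ] ℤ → M} (h : PzTruncated α β γ) (u u' : V)
    (p : ℤ × ℤ) :
    pzDefect z α β γ (u + u') p = pzDefect z α β γ u p + pzDefect z α β γ u' p := by
  have e1 (u : V) := finite_inX₁' (deltaX₁SubZ_above z) (h.fst u) p
  have e2 (u : V) := finite_inX₁ (deltaZSubX₁_below z) (h.snd u) p
  have e3 (u : V) := finite_inX₀ (deltaX₁SubX₀_neg z) (h.trd u) p
  have a1 (δ : V →ₗ[ℂ] ℤ → M) : δ (u + u') = fun i => δ u i + δ u' i := by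
    rw [map_add]; rfl
  simp only [pzDefect]
  rw [a1, a1, a1, inX₁_add, inX₁_add, inX₀_add, seriesMul_add (e1 u) (e1 u'),
    seriesMul_add (e2 u) (e2 u'), seriesMul_add (e3 u) (e3 u')]
  abel

theorem pzDefect_smul (z : ℂ) (α β γ : V →ₗ[ℂ] ℤ → M) (c : ℂ) (u : V)
    (p : ℤ × ℤ) : pzDefect z α β γ (c • u) p = c • pzDefect z α β γ u p := by
  have a1 (δ : V →ₗ[ℂ] ℤ → M) : δ (c • u) = fun i => c • δ u i := by
    rw [map_smul]; rfl
  simp only [pzDefect]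
  rw [a1, a1, a1, inX₁_smul, inX₁_smul, inX₀_smul, seriesMul_smul, seriesMul_smul,
    seriesMul_smul, smul_sub, smul_sub]

theorem pzDefect_zero (z : ℂ) (α β γ : V →ₗ[ℂ] ℤ → M) (p : ℤ × ℤ) :
    pzDefect z α β γ 0 p = 0 := by
  simpa using pzDefect_smul z α β γ 0 0 p

theorem pzOppDefect_eq_sum (𝒱 : VertexOperatorAlgebra V) (z : ℂ) {α β γ : V →ₗ[ℂ] ℤ → ℂ}
    (h : PzTruncated α β γ) (v : V) (p : ℤ × ℤ) :
    pzOppDefect 𝒱 z α β γ v p = ∑ k ∈ (𝒱.oppVec_finite v).toFinset,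
      pzDefect z α β γ (𝒱.oppVec v k) (p.1, k - p.2) := by
  have e1 (u : V) := finite_inX₁' (deltaX₁SubZ_above z) (h.fst u)
  have e2 (u : V) := finite_inX₁ (deltaZSubX₁_below z) (h.snd u)
  have e3 (u : V) := finite_inX₀ (deltaX₁SubX₀_neg z) (h.trd u)
  rw [pzOppDefect, seriesMul_inX₁_oppSeries 𝒱 e1, seriesMul_inX₁_oppSeries 𝒱 e2,
    seriesMul_oppVec 𝒱 e3, ← Finset.sum_sub_distrib, ← Finset.sum_sub_distrib]
  rfl

/-- The substitution is triangular for the weight filtration. For $u$ of weight $n$, the coefficient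
of $x^{-2n}$ is $(-1)^nu$, and every other nonzero coefficient is a multiple of $L(1)^ju$ with
$j>0$, of weight $n-j$. Induction on the weight starts below the lower bound `N`, where the weight
spaces vanish. -/
theorem pzDefect_eq_zero_iff (𝒱 : VertexOperatorAlgebra V) (z : ℂ) {α β γ : V →ₗ[ℂ] ℤ → ℂ}
    (h : PzTruncated α β γ) :
    (∀ u p, pzDefect z α β γ u p = 0) ↔ ∀ v p, pzOppDefect 𝒱 z α β γ v p = 0 := by
  constructor
  · intro H v p
    rw [pzOppDefect_eq_sum 𝒱 z h]
    exact Finset.sum_eq_zero fun k _ => H _ _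
  · intro H u
    obtain ⟨N, hN⟩ := 𝒱.lower_trunc
    have claim : ∀ (m : ℕ) (n : ℤ), n < N + m → ∀ u ∈ (𝒱.Y 𝒱.vir 1).eigenspace (n : ℂ),
        ∀ p, pzDefect z α β γ u p = 0 := by
      intro m
      induction m with
      | zero =>
        intro n hn u hu p
        rw [hN n (by simpa using hn), Submodule.mem_bot] at hu
        rw [hu, pzDefect_zero]
      | succ m ih =>
        intro n hn u hu p
        -- The exponent is chosen so that the term $k=-2n$, which carries $u$ itself, is evaluated
        -- exactly at `p`.
        have hs := H u (p.1, -2 * n - p.2)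
        rw [pzOppDefect_eq_sum 𝒱 z h, Finset.sum_eq_single (-2 * n)] at hs
        · rw [𝒱.oppVec_of_mem hu, if_pos (by omega), pzDefect_smul, smul_eq_mul] at hs
          simpa [zpow_ne_zero] using hs
        -- A remaining term is zero if $2n+k<0$. Otherwise $2n+k>0$, the vector has weight below
        -- $n$, and the induction hypothesis applies.
        · intro k _ hk
          rw [𝒱.oppVec_of_mem hu]
          split_ifs with h0
          · rw [pzDefect_smul, ih _ _ _ (𝒱.pow_mem hu _), smul_zero]
            omega
          · exact pzDefect_zero ..
        · intro hk
          have : 𝒱.oppVec u (-2 * n) = 0 := by simpa using hk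
          rw [this, pzDefect_zero]
    induction u using 𝒱.homogeneous_induction with
    | hom n u hu => exact claim (n + 1 - N).toNat n (by omega) u hu
    | zero => exact fun p => pzDefect_zero ..
    | add u u' hu hu' => exact fun p => by rw [pzDefect_add z h, hu, hu', add_zero]

end FormalCalculus

/-! ### Contragredient module and completion -/

section Contragredient

variable {V W : Type*} [AddCommGroup V] [Module ℂ V] [AddCommGroup W] [Module ℂ W]
  {𝒱 : VertexOperatorAlgebra V} (P : OrdinaryModule 𝒱.toVertexData W)

/-- The finitely many weights on which an element of `W'` does not vanish. -/
def OrdinaryModule.dualWeights (f : P.restrictedDual) : Finset ℂ :=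
  Set.Finite.toFinset (s := {h : ℂ | ∃ w ∈ P.weight h, (f : Module.Dual ℂ W) w ≠ 0}) f.2

theorem OrdinaryModule.apply_eq_zero {f : P.restrictedDual} {h : ℂ} (hh : h ∉ P.dualWeights f)
    {w : W} (hw : w ∈ P.weight h) : (f : Module.Dual ℂ W) w = 0 := by
  by_contra hne
  exact hh ((Set.Finite.mem_toFinset _).2 ⟨w, hw, hne⟩)

theorem OrdinaryModule.pairing_eq_sum (f : P.restrictedDual) (w : P.Completion) :
    P.pairing f w = ∑ h ∈ P.dualWeights f, (f : Module.Dual ℂ W) (w h) := by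
  refine finsum_eq_sum_of_support_subset _ fun h hh => ?_
  by_contra hne
  exact hh (P.apply_eq_zero (by simpa using hne) (w h).2)

/-- Since $W$ embeds in $\overline W$ by its components, identities in $W'$ may be tested by pairing
with $\overline W$. -/
theorem OrdinaryModule.apply_eq_pairing (f : P.restrictedDual) (w : W) :
    (f : Module.Dual ℂ W) w
      = P.pairing f fun h => wtProj (P.Y 𝒱.vir 1) P.isOrdinary.iSup_eq_top h w := by
  conv_lhs => rw [← finsum_wtProj _ P.isOrdinary.iSup_eq_top w]
  rw [map_finsum _ (finite_support_wtProj _ _ w)]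
  rfl

/-- This transposition characterises the extended mode and replaces its componentwise definition
from here on. The two sums may be exchanged because $f$ sees finitely many weights and each of those
receives contributions from finitely many weights of $w$. -/
theorem OrdinaryModule.pairing_extMode (f : P.restrictedDual) (u : V) (n : ℤ)
    (w : P.Completion) :
    P.pairing f (P.extMode u n w)
      = P.pairing ⟨(f : Module.Dual ℂ W) ∘ₗ P.Y u n, P.comp_mode_mem f.2 u n⟩ w := by
  have hfin (k : ℂ) : (Function.support fun h : ℂ =>
      wtProj (P.Y 𝒱.vir 1) P.isOrdinary.iSup_eq_top k (P.Y u n (w h : W))).Finite :=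
    (P.extMode_finite u n k).subset fun h hh => ⟨w h, (w h).2, hh⟩
  have hmap (k : ℂ) : (f : Module.Dual ℂ W) (P.extMode u n w k) = ∑ᶠ h : ℂ,
      (f : Module.Dual ℂ W)
        (wtProj (P.Y 𝒱.vir 1) P.isOrdinary.iSup_eq_top k (P.Y u n (w h : W))) :=
    map_finsum ((f : Module.Dual ℂ W) ∘ₗ (P.weight k).subtype) (hfin k)
  rw [pairing_eq_sum]
  simp only [hmap]
  rw [← finsum_sum_comm]
  · refine finsum_congr fun h => ?_
    rw [LinearMap.comp_apply, P.apply_eq_pairing, P.pairing_eq_sum]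
  · intro k _
    refine (hfin k).subset fun h hh h0 => hh ?_
    beta_reduce at h0 ⊢
    rw [h0, Submodule.coe_zero, map_zero]

/-- The linear functional on `W` which is `g` on `W_(h)` and zero on all other weight spaces. -/
def OrdinaryModule.extendDual (h : ℂ) : Module.Dual ℂ (P.weight h) →ₗ[ℂ] P.restrictedDual :=
  LinearMap.codRestrict P.restrictedDual
    (wtProj (P.Y 𝒱.vir 1) P.isOrdinary.iSup_eq_top h).dualMap fun g => by
      refine (Set.finite_singleton h).subset ?_
      rintro k ⟨w, hw, hne⟩
      by_contra hk
      exact hne (by rw [LinearMap.dualMap_apply, wtProj_of_ne _ _ hk hw, map_zero])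

theorem OrdinaryModule.pairing_extendDual (h : ℂ) (g : Module.Dual ℂ (P.weight h))
    (w : P.Completion) : P.pairing (P.extendDual h g) w = g (w h) := by
  have hval (k : ℂ) : (P.extendDual h g : Module.Dual ℂ W) (w k)
      = g (wtProj (P.Y 𝒱.vir 1) P.isOrdinary.iSup_eq_top h (w k)) := rfl
  refine (finsum_eq_single _ h fun k hk => ?_).trans ?_
  · rw [hval, wtProj_of_ne _ _ hk (w k).2, map_zero]
  · rw [hval]
    congr 1
    exact Subtype.ext (wtProj_of_mem _ _ (w h).2)

/-- $W'$ separates points because it contains every functional on a single $W_{(h)}$, extended by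
zero. -/
theorem OrdinaryModule.eq_zero_of_pairing {w : P.Completion} (hw : ∀ f, P.pairing f w = 0) :
    w = 0 := by
  funext h
  rw [Pi.zero_apply, ← Module.forall_dual_apply_eq_zero_iff ℂ]
  intro g
  rw [← P.pairing_extendDual, hw]

theorem OrdinaryModule.eq_zero_of_forall_pairing {f : P.restrictedDual}
    (hf : ∀ w, P.pairing f w = 0) : f = 0 := by
  ext w
  rw [P.apply_eq_pairing, hf]
  simp

theorem OrdinaryModule.sum_extendDual (f : P.restrictedDual) :
    f = ∑ h ∈ P.dualWeights f,
      P.extendDual h ((f : Module.Dual ℂ W) ∘ₗ (P.weight h).subtype) := by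
  rw [← sub_eq_zero]
  refine P.eq_zero_of_forall_pairing fun w => ?_
  rw [map_sub, LinearMap.sub_apply, map_sum, LinearMap.sum_apply, P.pairing_eq_sum, sub_eq_zero]
  exact Finset.sum_congr rfl fun h _ => by rw [P.pairing_extendDual]; rfl

/-! ### Extended modes and the contragredient action -/

theorem OrdinaryModule.extMode_add_left (u u' : V) (n : ℤ) (w : P.Completion) :
    P.extMode (u + u') n w = P.extMode u n w + P.extMode u' n w := by
  rw [← sub_eq_zero]
  refine P.eq_zero_of_pairing fun f => ?_
  rw [map_sub, map_add, P.pairing_extMode, P.pairing_extMode, P.pairing_extMode,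
    ← LinearMap.add_apply, ← map_add, sub_eq_zero]
  congr 2
  ext x
  simp

theorem OrdinaryModule.extMode_smul_left (c : ℂ) (u : V) (n : ℤ) (w : P.Completion) :
    P.extMode (c • u) n w = c • P.extMode u n w := by
  rw [← sub_eq_zero]
  refine P.eq_zero_of_pairing fun f => ?_
  rw [map_sub, map_smul, P.pairing_extMode, P.pairing_extMode,
    ← LinearMap.smul_apply, ← map_smul, sub_eq_zero]
  congr 2
  ext x
  simp

theorem VertexOperatorAlgebra.oppMode_eq_sum {M : Type*} [AddCommGroup M] [Module ℂ M]
    (𝒱 : VertexOperatorAlgebra V) (Y : V →ₗ[ℂ] ℤ → Module.End ℂ M) (v : V) (m : ℤ) :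
    𝒱.oppMode Y v m = ∑ k ∈ (𝒱.oppVec_finite v).toFinset, Y (𝒱.oppVec v k) (-m - 2 - k) := by
  refine finsum_eq_sum_of_support_subset _ fun k hk => ?_
  simp only [Set.Finite.coe_toFinset, Set.mem_ofPred_eq]
  intro h0
  simp [h0] at hk

/-- The adjunction defining $Y'$ persists on the completion: an opposite mode is a finite sum of
ordinary modes, and each of these transposes to its extension. -/
theorem OrdinaryModule.pairing_dualMode (v : V) (n : ℤ) (f : P.restrictedDual)
    (w : P.Completion) :
    P.pairing (P.dualMode v n f) w = ∑ k ∈ (𝒱.oppVec_finite v).toFinset,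
      P.pairing f (P.extMode (𝒱.oppVec v k) (-n - 2 - k) w) := by
  simp only [P.pairing_extMode]
  rw [← LinearMap.sum_apply, ← map_sum]
  congr 2
  ext x
  have h1 : (P.dualMode v n f : Module.Dual ℂ W) x
      = (f : Module.Dual ℂ W) (𝒱.oppMode P.Y v n x) := rfl
  rw [h1, 𝒱.oppMode_eq_sum]
  simp

/-- `⟨f, Y(u, x) w⟩` is a series in `x` that is truncated from above, uniformly in `w`. -/
theorem OrdinaryModule.pairing_extMode_trunc (f : P.restrictedDual) (u : V) :
    ∃ J : ℤ, ∀ j ≥ J, ∀ w : P.Completion, P.pairing f (P.extMode u (-j - 1) w) = 0 := by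
  choose J hJ using P.extMode_trunc u
  obtain ⟨K, hK⟩ := ((P.dualWeights f).finite_toSet.image J).bddAbove
  refine ⟨K, fun j hj w => ?_⟩
  rw [P.pairing_eq_sum]
  refine Finset.sum_eq_zero fun h hh => ?_
  rw [hJ h j (le_trans (hK (Set.mem_image_of_mem _ hh)) hj), Submodule.coe_zero, map_zero]

/-- Passing to $x^{-1}$ turns truncation from above of $\langle f,Y(u,x)w\rangle$ into truncation
from below. The bound being uniform in $w$, it annihilates the functional itself. -/
theorem OrdinaryModule.dualMode_trunc (v : V) (f : P.restrictedDual) :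
    ∃ N : ℤ, ∀ n ≥ N, P.dualMode v n f = 0 := by
  choose J hJ using fun u => P.pairing_extMode_trunc f u
  -- The mode $-n-2-k$ is the coefficient of $x^{n+1+k}$, so $n+1+k\ge J$ is needed for each of the
  -- finitely many $k$.
  obtain ⟨K, hK⟩ := ((𝒱.oppVec_finite v).image fun k => J (𝒱.oppVec v k) - k - 1).bddAbove
  refine ⟨K, fun n hn => P.eq_zero_of_forall_pairing fun w => ?_⟩
  rw [P.pairing_dualMode]
  refine Finset.sum_eq_zero fun k hk => ?_
  have h1 := hK (Set.mem_image_of_mem _ ((Set.Finite.mem_toFinset _).1 hk))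
  have h2 := hJ (𝒱.oppVec v k) (n + 1 + k) (by omega) w
  rwa [show -(n + 1 + k) - 1 = -n - 2 - k by ring] at h2

/-- `L(1) ω = 0`. -/
theorem VertexOperatorAlgebra.vir_two_vir (𝒱 : VertexOperatorAlgebra V) :
    𝒱.Y 𝒱.vir 2 𝒱.vir = 0 := by
  -- Apply $[L(1),L(-2)]=3L(-1)$ to the vacuum: $L(-2)\mathbf 1=\omega$, while $L(1)$ and $L(-1)$
  -- annihilate $\mathbf 1$.
  have h1 := congrArg (fun T : Module.End ℂ V => T 𝒱.vac) (𝒱.adjoint.virasoro 1 (-2))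
  obtain ⟨h2, h3⟩ := 𝒱.creation 𝒱.vir
  simpa [h2, h3] using h1

/-- As $\omega$ has weight $2$ and $L(1)\omega=0$, the exponential contributes only its constant
term and $x^{-4}\omega$ remains. -/
theorem VertexOperatorAlgebra.oppVec_vir (𝒱 : VertexOperatorAlgebra V) (k : ℤ) :
    𝒱.oppVec 𝒱.vir k = if k = -4 then 𝒱.vir else 0 := by
  rw [𝒱.oppVec_of_mem (n := 2) (by simpa using 𝒱.vir_mem)]
  by_cases hk : k = -4
  · subst hk
    simp
  · rw [if_neg hk]
    split_ifs with h
    · obtain ⟨j, hj⟩ : ∃ j : ℕ, (2 * 2 + k).toNat = j + 1 := ⟨(2 * 2 + k).toNat - 1, by omega⟩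
      rw [hj, pow_succ, Module.End.mul_apply, 𝒱.vir_two_vir, map_zero, smul_zero]
    · rfl

/-- `L'(0)` is the transpose of `L(0)`. -/
theorem OrdinaryModule.dualMode_vir (f : P.restrictedDual) (w : W) :
    (P.dualMode 𝒱.vir 1 f : Module.Dual ℂ W) w = (f : Module.Dual ℂ W) (P.Y 𝒱.vir 1 w) := by
  have h1 : 𝒱.oppMode P.Y 𝒱.vir 1 = P.Y 𝒱.vir 1 := by
    rw [VertexOperatorAlgebra.oppMode, finsum_eq_single _ (-4)]
    · simp [𝒱.oppVec_vir]
    · intro k hk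
      simp [𝒱.oppVec_vir, hk]
  have h2 : (P.dualMode 𝒱.vir 1 f : Module.Dual ℂ W) w
      = (f : Module.Dual ℂ W) (𝒱.oppMode P.Y 𝒱.vir 1 w) := rfl
  rw [h2, h1]

/-- Evaluating $f(L(0)w)$ on either side of the pairing gives $(h-\mu)f(w)=0$. -/
theorem OrdinaryModule.apply_of_mem_eigenspace {f : P.restrictedDual} {μ h : ℂ}
    (hf : f ∈ (P.dualMode 𝒱.vir 1).eigenspace μ) (hμ : h ≠ μ) {w : W} (hw : w ∈ P.weight h) :
    (f : Module.Dual ℂ W) w = 0 := by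
  rw [Module.End.mem_eigenspace_iff] at hf hw
  have h1 := P.dualMode_vir f w
  rw [hf, hw, map_smul] at h1
  simp only [Submodule.coe_smul, LinearMap.smul_apply, smul_eq_mul] at h1
  have h2 : (h - μ) * (f : Module.Dual ℂ W) w = 0 := by rw [sub_mul, ← h1, sub_self]
  exact (mul_eq_zero.1 h2).resolve_left (sub_ne_zero.2 hμ)

theorem OrdinaryModule.extendDual_mem (h : ℂ) (g : Module.Dual ℂ (P.weight h)) :
    P.extendDual h g ∈ (P.dualMode 𝒱.vir 1).eigenspace h := by
  rw [Module.End.mem_eigenspace_iff]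
  ext w
  rw [P.dualMode_vir]
  have hval (w : W) : (P.extendDual h g : Module.Dual ℂ W) w
      = g (wtProj (P.Y 𝒱.vir 1) P.isOrdinary.iSup_eq_top h w) := rfl
  simp only [Submodule.coe_smul, LinearMap.smul_apply]
  induction w using weight_induction _ P.isOrdinary.iSup_eq_top with
  | hom k w hw =>
    rw [Module.End.mem_eigenspace_iff.1 hw, map_smul]
    by_cases hk : k = h
    · rw [hk]
    · rw [hval, wtProj_of_ne _ _ hk hw, map_zero, smul_zero, smul_zero]
  | zero => simp
  | add w w' hw hw' => rw [map_add, map_add, map_add, hw, hw', smul_add]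

/-- An eigenvector for $\mu$ vanishes on all other weight spaces, so it is the extension by zero of
its restriction to $W_{(\mu)}$. Both grading restrictions on $W'$ follow from those on $W$. -/
theorem OrdinaryModule.eigenspace_dualMode_le (μ : ℂ) :
    (P.dualMode 𝒱.vir 1).eigenspace μ ≤ LinearMap.range (P.extendDual μ) := by
  intro f hf
  refine ⟨(f : Module.Dual ℂ W) ∘ₗ (P.weight μ).subtype, ?_⟩
  rw [← sub_eq_zero]
  refine P.eq_zero_of_forall_pairing fun w => ?_
  have h1 : P.pairing f w = (f : Module.Dual ℂ W) (w μ) :=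
    finsum_eq_single _ μ fun h hh => P.apply_of_mem_eigenspace hf hh (w h).2
  rw [map_sub, LinearMap.sub_apply, P.pairing_extendDual, h1]
  exact sub_self _

/-- The contragredient module has an ordinary grading. -/
theorem OrdinaryModule.isOrdinary_dual : IsOrdinaryGrading (P.dualMode 𝒱.vir 1) where
  iSup_eq_top := by
    rw [eq_top_iff]
    rintro f -
    rw [P.sum_extendDual f]
    exact Submodule.sum_mem _ fun h _ => Submodule.mem_iSup_of_mem h (P.extendDual_mem h _)
  finite_dimensional μ := by
    have := P.isOrdinary.finite_dimensional μ
    exact Submodule.finiteDimensional_of_le (P.eigenspace_dualMode_le μ)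
  lower_trunc := by
    obtain ⟨r, hr⟩ := P.isOrdinary.lower_trunc
    refine ⟨r, fun μ hμ => ?_⟩
    rw [eq_bot_iff]
    intro f hf
    obtain ⟨g, rfl⟩ := P.eigenspace_dualMode_le μ hf
    have : g = 0 := by
      ext w
      have hw : w = 0 := Subtype.ext ((Submodule.mem_bot ℂ).1 (hr μ hμ ▸ w.2))
      rw [hw, map_zero, map_zero]
    rw [this, map_zero]
    exact Submodule.zero_mem _

end Contragredient

/-! ### `P(z)`-intertwining maps and homomorphisms out of the contragredient module -/

section Correspondence

variable {V W A : Type*} [AddCommGroup V] [Module ℂ V] [AddCommGroup W] [Module ℂ W]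
  [AddCommGroup A] [Module ℂ A] {𝒱 : VertexOperatorAlgebra V}
  (P : OrdinaryModule 𝒱.toVertexData W)

/-- The coefficients of `L(α(u, x))`. -/
def postComp {M N : Type*} [AddCommGroup M] [Module ℂ M] [AddCommGroup N] [Module ℂ N]
    (L : M →ₗ[ℂ] N) (α : V →ₗ[ℂ] ℤ → M) : V →ₗ[ℂ] ℤ → N :=
  L.compLeft ℤ ∘ₗ α

theorem postComp_apply {M N : Type*} [AddCommGroup M] [Module ℂ M] [AddCommGroup N] [Module ℂ N]
    (L : M →ₗ[ℂ] N) (α : V →ₗ[ℂ] ℤ → M) (u : V) : postComp L α u = fun j => L (α u j) := rfl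

/-- The coefficients of the powers of `x` in `Y(u, x) a`. -/
def modeSeries (Y : V →ₗ[ℂ] ℤ → Module.End ℂ A) (a : A) : V →ₗ[ℂ] ℤ → A where
  toFun u j := Y u (-j - 1) a
  map_add' u u' := by ext j; simp
  map_smul' c u := by ext j; simp

/-- The coefficients of the powers of `x` in `Y(u, x) w`, for `w` in the completion. -/
def OrdinaryModule.extSeries (w : P.Completion) : V →ₗ[ℂ] ℤ → P.Completion where
  toFun u j := P.extMode u (-j - 1) w
  map_add' u u' := by ext j : 1; exact P.extMode_add_left ..
  map_smul' c u := by ext j : 1; exact P.extMode_smul_left ..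

/-- Products with coefficients in $\overline W$ exist only weight by weight. That suffices here,
since $f$ involves finitely many weights. -/
theorem OrdinaryModule.pairing_seriesMul (f : P.restrictedDual) {D : ℤ × ℤ → ℂ}
    {g : ℤ × ℤ → P.Completion} {p : ℤ × ℤ}
    (hg : ∀ h, (Function.support fun r => D (p - r) • g r h).Finite) :
    P.pairing f (fun h => seriesMul D (fun r => g r h) p)
      = seriesMul D (fun r => P.pairing f (g r)) p := by
  have hmap (h : ℂ) : (f : Module.Dual ℂ W) (seriesMul D (fun r => g r h) p : P.weight h)
      = ∑ᶠ r, D (p - r) • (f : Module.Dual ℂ W) (g r h) :=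
    map_seriesMul ((f : Module.Dual ℂ W) ∘ₗ (P.weight h).subtype) (hg h)
  rw [P.pairing_eq_sum]
  simp only [hmap]
  rw [← finsum_sum_comm, seriesMul]
  · exact finsum_congr fun r => by rw [P.pairing_eq_sum, Finset.smul_sum]
  · intro h _
    refine (hg h).subset fun r hr h0 => hr ?_
    have h1 := congrArg (fun w : P.weight h => (f : Module.Dual ℂ W) w) h0
    simpa using h1

theorem OrdinaryModule.pairing_pzDefect (f : P.restrictedDual) (z : ℂ)
    {α β γ : V →ₗ[ℂ] ℤ → P.Completion}
    (H : ∀ h, PzTruncated (postComp (LinearMap.proj h) α) (postComp (LinearMap.proj h) β)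
      (postComp (LinearMap.proj h) γ)) (u : V) (p : ℤ × ℤ) :
    P.pairing f (fun h => pzDefect z (postComp (LinearMap.proj h) α)
        (postComp (LinearMap.proj h) β) (postComp (LinearMap.proj h) γ) u p)
      = pzDefect z (postComp (P.pairing f) α) (postComp (P.pairing f) β)
          (postComp (P.pairing f) γ) u p := by
  have i0 (δ : V →ₗ[ℂ] ℤ → P.Completion) (h : ℂ) : inX₀ (postComp (LinearMap.proj h) δ u)
      = fun r => inX₀ (δ u) r h := (map_inX₀ (LinearMap.proj h) (δ u)).symm
  have i1 (δ : V →ₗ[ℂ] ℤ → P.Completion) (h : ℂ) : inX₁ (postComp (LinearMap.proj h) δ u)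
      = fun r => inX₁ (δ u) r h := (map_inX₁ (LinearMap.proj h) (δ u)).symm
  have e1 (h : ℂ) := finite_inX₁' (deltaX₁SubZ_above z) ((H h).fst u) p
  have e2 (h : ℂ) := finite_inX₁ (deltaZSubX₁_below z) ((H h).snd u) p
  have e3 (h : ℂ) := finite_inX₀ (deltaX₁SubX₀_neg z) ((H h).trd u) p
  simp only [i0, i1] at e1 e2 e3
  simp only [pzDefect, i0, i1]
  rw [postComp_apply, postComp_apply, postComp_apply, ← map_inX₁, ← map_inX₁, ← map_inX₀,
    ← P.pairing_seriesMul f e1, ← P.pairing_seriesMul f e2, ← P.pairing_seriesMul f e3,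
    ← map_sub, ← map_sub]
  rfl

/-! ### From the intertwining identity to the compatibility identity -/

variable (S : WeakModule (𝒱.tensor 𝒱) A)

theorem WeakModule.right_trunc (u : V) (a : A) :
    ∃ N : ℤ, ∀ i ≤ N, modeSeries S.right a u i = 0 := by
  obtain ⟨N, hN⟩ := S.isWeakModule.trunc (𝒱.vac ⊗ₜ u) a
  exact ⟨-N - 1, fun j hj => hN _ (by omega)⟩

theorem WeakModule.left_trunc (u : V) (a : A) :
    ∃ N : ℤ, ∀ i ≤ N, modeSeries S.left a u i = 0 := by
  obtain ⟨N, hN⟩ := S.isWeakModule.trunc (u ⊗ₜ 𝒱.vac) a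
  exact ⟨-N - 1, fun j hj => hN _ (by omega)⟩

variable {P}

/-- Applied with `L` a weight component and with `L` the pairing with some $f\in W'$. Truncation of
the last two families already holds in $A$; that of $Y(u,x)F(a)$ is assumed only after `L`, as it
need not hold in $\overline W$. -/
theorem pzTruncated_of_linear {N : Type*} [AddCommGroup N] [Module ℂ N]
    (F : A →ₗ[ℂ] P.Completion) (a : A) (L : P.Completion →ₗ[ℂ] N)
    (hL : ∀ u, ∃ J : ℤ, ∀ j ≥ J, L (P.extMode u (-j - 1) (F a)) = 0) :
    PzTruncated (postComp L (P.extSeries (F a)))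
      (postComp L (postComp F (modeSeries S.right a)))
      (postComp L (postComp F (modeSeries S.left a))) where
  fst := hL
  snd u := by
    obtain ⟨N, hN⟩ := S.right_trunc u a
    exact ⟨N, fun i hi => by simp only [postComp_apply, hN i hi, map_zero]⟩
  trd u := by
    obtain ⟨N, hN⟩ := S.left_trunc u a
    exact ⟨N, fun i hi => by simp only [postComp_apply, hN i hi, map_zero]⟩

theorem dualRestrict_apply (F : A →ₗ[ℂ] P.Completion) (f : P.restrictedDual) (a : A) :
    dualRestrict P F f a = P.pairing f (F a) := rfl

/-- This is where the contragredient action enters: the substitution changes $\langle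
f,Y(v,x_1)F(a)\rangle$ into $\langle Y'(v,x_1)f,F(a)\rangle$. -/
theorem oppSeries_extSeries (F : A →ₗ[ℂ] P.Completion) (f : P.restrictedDual) (a : A) (v : V) :
    oppSeries 𝒱 (postComp (P.pairing f) (P.extSeries (F a))) v
      = fun j => dualRestrict P F (P.dualMode v (-j - 1) f) a := by
  funext j
  rw [oppSeries_eq_sum, dualRestrict_apply, P.pairing_dualMode]
  refine Finset.sum_congr rfl fun k _ => ?_
  rw [show -(-j - 1) - 2 - k = -(k - j) - 1 by ring]
  rfl

theorem oppSeries_right (F : A →ₗ[ℂ] P.Completion) (f : P.restrictedDual) (a : A) (v : V) :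
    oppSeries 𝒱 (postComp (P.pairing f) (postComp F (modeSeries S.right a))) v
      = S.rightOppSeries v (dualRestrict P F f) a := by
  funext j
  rw [oppSeries_eq_sum, WeakModule.rightOppSeries, 𝒱.oppMode_eq_sum, LinearMap.sum_apply, map_sum]
  refine Finset.sum_congr rfl fun k _ => ?_
  rw [show -(-j - 1) - 2 - k = -(k - j) - 1 by ring]
  rfl

/-- `F` is a `P(z)`-intertwining map if and only if all `F^*(f)`, `f ∈ W'`, satisfy the
Jacobi-type identity in which `F^*(Y'(v, x₁) f)` takes the place of
`Y'_{P(z)}(v, x₁) F^*(f)`. -/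
theorem isPzIntertwining_iff (z : ℂ) (F : A →ₗ[ℂ] P.Completion) :
    IsPzIntertwining S P z F ↔ ∀ (f : P.restrictedDual) (v : V) (a : A) (p : ℤ × ℤ),
      seriesMul (substInv (deltaX₁SubZ z))
          (inX₁ fun j => dualRestrict P F (P.dualMode v (-j - 1) f) a) p
        = S.pzSeries z v (dualRestrict P F f) a p := by
  have hcomp (a : A) (h : ℂ) := pzTruncated_of_linear S F a (LinearMap.proj h) fun u => by
    obtain ⟨J, hJ⟩ := P.extMode_trunc u h
    exact ⟨J, fun j hj => hJ j hj _⟩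
  have hpair (a : A) (f : P.restrictedDual) := pzTruncated_of_linear S F a (P.pairing f) fun u => by
    obtain ⟨J, hJ⟩ := P.pairing_extMode_trunc f u
    exact ⟨J, fun j hj => hJ j hj _⟩
  have step1 : IsPzIntertwining S P z F ↔ ∀ (a : A) (f : P.restrictedDual) (v : V) (p : ℤ × ℤ),
      pzDefect z (postComp (P.pairing f) (P.extSeries (F a)))
        (postComp (P.pairing f) (postComp F (modeSeries S.right a)))
        (postComp (P.pairing f) (postComp F (modeSeries S.left a))) v p = 0 := by
    constructor
    · intro H a f v p
      rw [← P.pairing_pzDefect f z (hcomp a)]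
      convert map_zero (P.pairing f) using 2
      funext h
      exact sub_eq_zero.2 (H v a h p)
    · intro H v a h p
      have h0 : (fun h => pzDefect z (postComp (LinearMap.proj h) (P.extSeries (F a)))
          (postComp (LinearMap.proj h) (postComp F (modeSeries S.right a)))
          (postComp (LinearMap.proj h) (postComp F (modeSeries S.left a))) v p)
            = (0 : P.Completion) :=
        P.eq_zero_of_pairing fun f => by rw [P.pairing_pzDefect f z (hcomp a), H]
      exact sub_eq_zero.1 (congrFun h0 h)
  rw [step1]
  -- With $a$ and $f$ fixed, the equivalence concerns the identities for all $v$ at once; undoing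
  -- the substitution for one vector uses those of lower weight.
  simp only [pzDefect_eq_zero_iff 𝒱 z (hpair _ _)]
  have step2 (a : A) (f : P.restrictedDual) (v : V) (p : ℤ × ℤ) :
      pzOppDefect 𝒱 z (postComp (P.pairing f) (P.extSeries (F a)))
        (postComp (P.pairing f) (postComp F (modeSeries S.right a)))
        (postComp (P.pairing f) (postComp F (modeSeries S.left a))) v p = 0 ↔
      seriesMul (substInv (deltaX₁SubZ z))
          (inX₁ fun j => dualRestrict P F (P.dualMode v (-j - 1) f) a) p
        = S.pzSeries z v (dualRestrict P F f) a p := by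
    rw [pzOppDefect, oppSeries_extSeries, oppSeries_right, sub_sub, sub_eq_zero,
      WeakModule.pzSeries, add_comm (seriesMul _ (S.leftOppSeries _ _ _) _)]
    rfl
  simp only [step2]
  exact ⟨fun H f v a p => H a f v p, fun H a f v p => H f v a p⟩

/-- Compare coefficients of $x_0^{-1}$: the left side reduces to $F^*(Y'(v,x)f)$, and the right side
is the definition of $Y'_{P(z)}(v,x)F^*(f)$. -/
theorem IsPzIntertwining.dualRestrict_dualMode {z : ℂ} {F : A →ₗ[ℂ] P.Completion}
    (hF : IsPzIntertwining S P z F) (v : V) (n : ℤ) (f : P.restrictedDual) :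
    dualRestrict P F (P.dualMode v n f) = S.pzMode z v n (dualRestrict P F f) := by
  ext a
  have h := (isPzIntertwining_iff S z F).1 hF f v a (-1, -n - 1)
  rw [seriesMul_substInv_deltaX₁SubZ_residue] at h
  rwa [show -(-n - 1) - 1 = n by ring] at h

theorem IsPzIntertwining.isPzCompatible {z : ℂ} {F : A →ₗ[ℂ] P.Completion}
    (hF : IsPzIntertwining S P z F) (f : P.restrictedDual) :
    S.IsPzCompatible z (dualRestrict P F f) where
  lower_trunc v := by
    obtain ⟨N, hN⟩ := P.dualMode_trunc v f
    exact ⟨N, fun n hn => by rw [← hF.dualRestrict_dualMode, hN n hn, map_zero]⟩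
  jacobi v a p := by
    simp only [← hF.dualRestrict_dualMode]
    exact (isPzIntertwining_iff S z F).1 hF f v a p

/-- A linear map `F` such that `F^*` is a homomorphism into the space of functionals satisfying
the `P(z)`-compatibility condition is a `P(z)`-intertwining map. -/
theorem isPzIntertwining_of_dualRestrict {z : ℂ} {F : A →ₗ[ℂ] P.Completion}
    (hc : ∀ f, S.IsPzCompatible z (dualRestrict P F f))
    (hm : ∀ v n f, dualRestrict P F (P.dualMode v n f) = S.pzMode z v n (dualRestrict P F f)) :
    IsPzIntertwining S P z F := by
  rw [isPzIntertwining_iff]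
  intro f v a p
  simp only [hm]
  exact (hc f).jacobi v a p

/-! ### The isomorphism onto $\operatorname{Hom}_V(W',T'_{P(z)}(A))$ -/

theorem WeakModule.pzDual_le (z : ℂ) : S.pzDual z ≤ S.pzTilde z :=
  sSup_le fun _ hU => hU.le

/-- The image of a homomorphism from `W'` is an ordinary submodule. -/
theorem isOrdinarySubmodule_range {z : ℂ} {G : P.restrictedDual →ₗ[ℂ] Module.Dual ℂ A}
    (hc : ∀ f, S.IsPzCompatible z (G f))
    (hm : ∀ v n f, G (P.dualMode v n f) = S.pzMode z v n (G f)) :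
    S.IsOrdinarySubmodule z (LinearMap.range G) where
  le := by
    rintro _ ⟨f, rfl⟩
    exact hc f
  stable := by
    rintro v n _ ⟨f, rfl⟩
    exact ⟨_, hm v n f⟩
  isOrdinary := P.isOrdinary_dual.of_surjective (G := G.rangeRestrict)
    (fun f => Subtype.ext (hm 𝒱.vir 1 f)) G.surjective_rangeRestrict

theorem dualRestrict_injective : Function.Injective fun F : A →ₗ[ℂ] P.Completion =>
    dualRestrict P F := by
  intro F F' h
  ext a : 1
  rw [← sub_eq_zero]
  refine P.eq_zero_of_pairing fun f => ?_
  rw [map_sub, ← dualRestrict_apply, ← dualRestrict_apply, sub_eq_zero]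
  exact congrArg (fun G : P.restrictedDual →ₗ[ℂ] Module.Dual ℂ A => G f a) h

/-- As the weight spaces are finite-dimensional, every linear map `W' → A^*` is `F^*` for some
`F : A → ∏_h W_(h)`. -/
theorem dualRestrict_surjective : Function.Surjective fun F : A →ₗ[ℂ] P.Completion =>
    dualRestrict P F := by
  intro G
  have := P.isOrdinary.finite_dimensional
  -- For fixed $a$, the map $g\mapsto G(g)(a)$ on $W_{(h)}^*$ is an element of
  -- $W_{(h)}^{**}=W_{(h)}$. It is taken as the $h$-component of $F(a)$.
  let F : A →ₗ[ℂ] P.Completion := LinearMap.pi fun h =>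
    (Module.evalEquiv ℂ (P.weight h)).symm.toLinearMap ∘ₗ (G ∘ₗ P.extendDual h).flip
  have hF (a : A) (h : ℂ) (g : Module.Dual ℂ (P.weight h)) : g (F a h) = G (P.extendDual h g) a :=
    Module.apply_evalEquiv_symm_apply ..
  refine ⟨F, LinearMap.ext fun f => LinearMap.ext fun a => ?_⟩
  rw [dualRestrict_apply, P.pairing_eq_sum]
  conv_rhs => rw [P.sum_extendDual f, map_sum, LinearMap.sum_apply]
  exact Finset.sum_congr rfl fun h _ =>
    hF a h ((f : Module.Dual ℂ W) ∘ₗ (P.weight h).subtype)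

/-- The image of $F^*$ is itself one of the ordinary submodules whose sum is $T'_{P(z)}(A)$. -/
theorem IsPzIntertwining.dualRestrict_mem {z : ℂ} {F : A →ₗ[ℂ] P.Completion}
    (hF : IsPzIntertwining S P z F) (f : P.restrictedDual) :
    dualRestrict P F f ∈ S.pzDual z :=
  Submodule.mem_sSup_of_mem
    (isOrdinarySubmodule_range S hF.isPzCompatible hF.dualRestrict_dualMode)
    (LinearMap.mem_range_self _ f)

/-- The map `F ↦ F^*` from `P(z)`-intertwining maps to homomorphisms from `W'`. -/
def pzDualRestrict (P : OrdinaryModule 𝒱.toVertexData W) (z : ℂ) :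
    pzIntertwining S P z →ₗ[ℂ] vertexHom P.dualMode (S.pzMode z) (S.pzDual z) where
  toFun F := ⟨(dualRestrict P F.1).codRestrict (S.pzDual z)
    (IsPzIntertwining.dualRestrict_mem S F.2), IsPzIntertwining.dualRestrict_dualMode S F.2⟩
  map_add' F F' := by
    ext f a
    exact map_add (P.pairing f) (F.1 a) (F'.1 a)
  map_smul' c F := by
    ext f a
    exact map_smul (P.pairing f) c (F.1 a)

theorem pzDualRestrict_bijective (z : ℂ) : Function.Bijective (pzDualRestrict S P z) := by
  constructor
  · intro F F' h
    refine Subtype.ext (dualRestrict_injective (LinearMap.ext fun f => ?_))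
    exact congrArg (fun G : vertexHom P.dualMode (S.pzMode z) (S.pzDual z) =>
      (G.1 f : Module.Dual ℂ A)) h
  · intro G
    -- Linear algebra alone supplies `F`. It is intertwining because `G` commutes with the modes and
    -- its values, lying in $T'_{P(z)}(A)$, are compatible.
    obtain ⟨F, hF⟩ := dualRestrict_surjective (P := P) ((S.pzDual z).subtype ∘ₗ G.1)
    have hF' (f : P.restrictedDual) : dualRestrict P F f = G.1 f := LinearMap.congr_fun hF f
    refine ⟨⟨F, isPzIntertwining_of_dualRestrict S (fun f => ?_) fun v n f => ?_⟩, ?_⟩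
    · rw [hF']
      exact S.pzDual_le z (G.1 f).2
    · rw [hF', hF']
      exact G.2 v n f
    · exact Subtype.ext (LinearMap.ext fun f => Subtype.ext (hF' f))

end Correspondence

end

theorem theorem6p11 {V A W : Type*} [AddCommGroup V] [Module ℂ V] [AddCommGroup A] [Module ℂ A]
    [AddCommGroup W] [Module ℂ W] (𝒱 : VertexOperatorAlgebra V)
    (S : WeakModule (𝒱.tensor 𝒱) A) (P : OrdinaryModule 𝒱.toVertexData W) (z : ℂ) (hz : z ≠ 0) :
    (∀ F : A →ₗ[ℂ] P.Completion,
      IsPzIntertwining S P z F ↔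
        ∃ G ∈ vertexHom P.dualMode (S.pzMode z) (S.pzTilde z),
          ∀ f : P.restrictedDual, (G f : Module.Dual ℂ A) = dualRestrict P F f) ∧
    ∃ e : pzIntertwining S P z ≃ₗ[ℂ] vertexHom P.dualMode (S.pzMode z) (S.pzDual z),
      ∀ (F : pzIntertwining S P z) (f : P.restrictedDual),
        ((e F : P.restrictedDual →ₗ[ℂ] S.pzDual z) f : Module.Dual ℂ A)
          = dualRestrict P (F : A →ₗ[ℂ] P.Completion) f := by
  refine ⟨fun F => ⟨fun hF => ?_, ?_⟩,
    LinearEquiv.ofBijective (pzDualRestrict S P z) (pzDualRestrict_bijective S z),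
    fun F f => rfl⟩
  · exact ⟨(dualRestrict P F).codRestrict (S.pzTilde z) (IsPzIntertwining.isPzCompatible S hF),
      IsPzIntertwining.dualRestrict_dualMode S hF, fun f => rfl⟩
  · rintro ⟨G, hG, hGF⟩
    refine isPzIntertwining_of_dualRestrict S (fun f => ?_) fun v n f => ?_
    · rw [← hGF]
      exact (G f).2
    · rw [← hGF, ← hGF]
      exact hG v n f
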